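/- Let $n\ge 0$ and let $Q_1,\dots,Q_n$ be the generators of the Clifford algebra acting on $(\mathbb C^2)^{\otimes n}$, $Q_j = U\otimes\cdots\otimes U\otimes Q\otimes I\otimes\cdots\otimes I$ with $Q=\begin{pmatrix}0&1\\1&0\end{pmatrix}$ in position $j$ and $U=\begin{pmatrix}1&0\\0&-1\end{pmatrix}$, so that $Q_iQ_j+Q_jQ_i=2\delta_{ij}I$. Let $\mathfrak C$ be the complex algebra they generate, $\tau=2^{-n}\operatorname{tr}$ the normalized trace, and $\Gamma$ the automorphism of $\mathfrak C$ with $\Gamma(Q_j)=-Q_j$. Put $$\nabla_i A=\tfrac12\bigl(Q_iA-\Gamma(A)Q_i\bigr),\qquad \nabla_i^*A=\tfrac12\bigl(Q_iA+\Gamma(A)Q_i\bigr),$$ $\nabla A=(\nabla_1A,\dots,\nabla_nA)$ and $\operatorname{div}(V_1,\dots,V_n)=-\sum_i\nabla_i^*V_i$. Let $\mathfrak P_+$ be the set of strictly positive $\rho\in\mathfrak C$ with $\tau(\rho)=1$, and let $S(\rho)=\tau(\rho\log\rho)$. For $\rho\in\mathfrak P_+$ and $V=(V_1,\dots,V_n)\in\mathfrak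 C^n$ let $(\Gamma(\rho),\rho)\#V$ be the vector field with components $\int_0^1\Gamma(\rho)^{1-s}\,V_i\,\rho^s\,ds$. For a continuously differentiable curve $\rho(t)$ in $\mathfrak P_+$, put $$g_{\rho(t)}(\dot\rho(t),\dot\rho(t))=\sum_{i=1}^n\tau\Bigl[(\nabla_iU)^*\,\bigl((\Gamma(\rho(t)),\rho(t))\#\nabla U\bigr)_i\Bigr],$$ where $\nabla U$, $U\in\mathfrak C$, is the unique gradient with $\dot\rho(t)+\operatorname{div}\bigl((\Gamma(\rho(t)),\rho(t))\#\nabla U\bigr)=0$. Let $d(\rho_0,\rho_1)$ be the infimum of the arclengths $\int_0^1\sqrt{g_{\rho(t)}(\dot\rho(t),\dot\rho(t))}\,dt$ over all curves $\rho:[0,1]\to\mathfrak P_+$ that are continuous on $[0,1]$, smooth on $(0,1)$, and satisfy $\rho(0)=\rho_0$, $\rho(1)=\rho_1$. **Theorem (Talagrand type inequality).** For every $\rho\in\mathfrak P_+$, $$d(\rho,I)\le\sqrt{2S(\rho)}\,.$$ -/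

import Mathlib

open scoped Matrix ENNReal ContDiff ComplexOrder

namespace FermiClifford

/-! ### The Clifford algebra as an operator algebra -/

/-- Operators on the `n`-fold tensor power of `ℂ²`, as complex matrices indexed by `{0,1}ⁿ`. -/
abbrev Op (n : ℕ) : Type := Matrix (Fin n → Fin 2) (Fin n → Fin 2) ℂ

/-- The elementary tensor `X₁ ⊗ ⋯ ⊗ Xₙ` of `2 × 2` matrices. -/
def tensor {n : ℕ} (X : Fin n → Matrix (Fin 2) (Fin 2) ℂ) : Op n :=
  Matrix.of fun x y => ∏ i, X i (x i) (y i)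

/-- The `2 × 2` matrix `Q`. -/
def qMat : Matrix (Fin 2) (Fin 2) ℂ := !![0, 1; 1, 0]

/-- The `2 × 2` matrix `U`. -/
def uMat : Matrix (Fin 2) (Fin 2) ℂ := !![1, 0; 0, -1]

/-- The generator `Q_j = U ⊗ ⋯ ⊗ U ⊗ Q ⊗ I ⊗ ⋯ ⊗ I`, with `Q` in position `j`. -/
def gen {n : ℕ} (j : Fin n) : Op n :=
  tensor fun i => if i < j then uMat else if i = j then qMat else 1

/-- The Clifford algebra: the operator algebra generated by `Q_1, …, Q_n`. (It is closed under
adjoints, since the generators are self-adjoint.) -/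
def cliff (n : ℕ) : Subalgebra ℂ (Op n) := Algebra.adjoin ℂ (Set.range gen)

/-- The normalized trace `τ(A) = 2⁻ⁿ tr A`. -/
noncomputable def tau {n : ℕ} (A : Op n) : ℂ := ((2 : ℂ) ^ n)⁻¹ * A.trace

/-- The monomial `Q^α = Q_1^{α_1} ⋯ Q_n^{α_n}` for a multi-index `α ∈ {0,1}ⁿ`. -/
noncomputable def monomial {n : ℕ} (α : Fin n → Fin 2) : Op n :=
  (List.ofFn fun j => gen j ^ (α j : ℕ)).prod

/-- The grading operator `Γ` (principal automorphism), implemented as conjugation by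
`U ⊗ ⋯ ⊗ U`; see `grading_monomial`. -/
def grading {n : ℕ} (A : Op n) : Op n :=
  tensor (fun _ => uMat) * A * tensor (fun _ => uMat)

/-! ### Differential calculus -/

/-- The partial derivative `∇_i A = ½ (Q_i A - Γ(A) Q_i)`; see `partialD_monomial`. -/
noncomputable def partialD {n : ℕ} (i : Fin n) (A : Op n) : Op n :=
  (1 / 2 : ℂ) • (gen i * A - grading A * gen i)

/-- The adjoint `∇_i^* A = ½ (Q_i A + Γ(A) Q_i)` of `∇_i` in `L²(τ)`; see `tau_partialD`. -/
noncomputable def partialDAdj {n : ℕ} (i : Fin n) (A : Op n) : Op n :=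
  (1 / 2 : ℂ) • (gen i * A + grading A * gen i)

/-- The gradient `∇A = (∇_1 A, …, ∇_n A)`. -/
noncomputable def grad {n : ℕ} (A : Op n) : Fin n → Op n := fun i => partialD i A

/-- The divergence `div V = - ∑ i, ∇_i^* V_i`. -/
noncomputable def dive {n : ℕ} (V : Fin n → Op n) : Op n := -∑ i, partialDAdj i (V i)

/-! ### Probability densities, entropy, and multiplication by a density -/

/-- The strictly positive probability densities: strictly positive `ρ` in the Clifford algebra
with `τ(ρ) = 1`. -/
def densPos (n : ℕ) : Set (Op n) := {ρ | ρ ∈ cliff n ∧ ρ.PosDef ∧ tau ρ = 1}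

/-- The relative entropy `S(ρ) = τ(ρ log ρ)`, a real number. -/
noncomputable def entropy {n : ℕ} (ρ : Op n) : ℝ := (tau (ρ * cfc Real.log ρ)).re

/-- The real power `A ^ s` of a positive definite matrix, by functional calculus. -/
noncomputable def rpowOp {n : ℕ} (A : Op n) (s : ℝ) : Op n := cfc (fun x : ℝ => x ^ s) A

/-- `(A, B) # C = ∫₀¹ A^{1-s} C B^s ds`, the matrix integral being taken entry by entry. -/
noncomputable def sharp {n : ℕ} (A B C : Op n) : Op n :=
  Matrix.of fun x y => ∫ s in (0 : ℝ)..1, (rpowOp A (1 - s) * C * rpowOp B s) x y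

/-- `(Γ(ρ), ρ) # V`, acting on each component of a vector field `V`. -/
noncomputable def sharpField {n : ℕ} (ρ : Op n) (V : Fin n → Op n) : Fin n → Op n :=
  fun i => sharp (grading ρ) ρ (V i)

/-- `‖V‖_ρ² = τ(V^* · (Γ(ρ), ρ) # V)`. -/
noncomputable def normSqAt {n : ℕ} (ρ : Op n) (V : Fin n → Op n) : ℝ :=
  (∑ i, tau ((V i)ᴴ * sharpField ρ V i)).re

/-! ### The Riemannian metric and its distance -/

/-- `V` is a gradient `∇U`, with `U` in the Clifford algebra, that solves the continuity equation
`X + div ((Γ(ρ), ρ) # V) = 0` for the velocity `X`. -/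
def IsTangentField {n : ℕ} (ρ X : Op n) (V : Fin n → Op n) : Prop :=
  (∃ U ∈ cliff n, V = grad U) ∧ X + dive (sharpField ρ V) = 0

open Classical in
/-- The metric `g_ρ(X, X) = ‖∇U‖_ρ²`, where `∇U` is the unique gradient that solves the continuity
equation for `X`. Such a gradient exists for every velocity `X` of a curve of strictly positive
densities; otherwise the value is set to `∞`. -/
noncomputable def metric {n : ℕ} (ρ X : Op n) : ℝ≥0∞ :=
  if h : ∃ V, IsTangentField ρ X V then ENNReal.ofReal (normSqAt ρ h.choose) else ∞

/-- The velocity of a curve of matrices (entrywise derivative). -/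
noncomputable def velocity {n : ℕ} (γ : ℝ → Op n) (t : ℝ) : Op n :=
  Matrix.of fun x y => deriv (fun s => γ s x y) t

/-- The couplings of `ρ₀` and `ρ₁`: curves from `[0,1]` to the strictly positive densities that are
continuous on `[0,1]`, smooth on `(0,1)`, and run from `ρ₀` to `ρ₁`. (Values outside `[0,1]` are
irrelevant.) -/
structure IsCoupling {n : ℕ} (ρ₀ ρ₁ : Op n) (γ : ℝ → Op n) : Prop where
  mem : ∀ t ∈ Set.Icc (0 : ℝ) 1, γ t ∈ densPos n
  cont : ContinuousOn γ (Set.Icc 0 1)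
  smooth : ∀ x y, ContDiffOn ℝ ∞ (fun t => γ t x y) (Set.Ioo 0 1)
  start : γ 0 = ρ₀
  finish : γ 1 = ρ₁

/-- The arclength `∫₀¹ √(g_{γ(t)}(γ'(t), γ'(t))) dt`, possibly infinite. -/
noncomputable def arclength {n : ℕ} (γ : ℝ → Op n) : ℝ≥0∞ :=
  ∫⁻ t in Set.Ioo (0 : ℝ) 1, metric (γ t) (velocity γ t) ^ (1 / 2 : ℝ)

/-- The Riemannian distance: the infimum of the arclengths of all couplings. -/
noncomputable def riemannianDist {n : ℕ} (ρ₀ ρ₁ : Op n) : ℝ≥0∞ :=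
  ⨅ (γ : ℝ → Op n) (_ : IsCoupling ρ₀ ρ₁ γ), arclength γ

/-! ### The generators, the grading and the derivatives are the standard ones -/

theorem tensor_mul {n : ℕ} (X Y : Fin n → Matrix (Fin 2) (Fin 2) ℂ) :
    tensor X * tensor Y = tensor fun i => X i * Y i := by
  ext x y
  simp only [tensor, Matrix.mul_apply, Matrix.of_apply, ← Finset.prod_mul_distrib]
  rw [Finset.prod_univ_sum]
  simp

theorem tensor_one {n : ℕ} : tensor (fun _ : Fin n => (1 : Matrix (Fin 2) (Fin 2) ℂ)) = 1 := by
  ext x y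
  by_cases h : x = y
  · subst h; simp [tensor]
  · obtain ⟨i, hi⟩ := Function.ne_iff.mp h
    rw [Matrix.one_apply_ne h]
    exact Finset.prod_eq_zero (Finset.mem_univ i) (Matrix.one_apply_ne hi)

theorem tensor_neg {n : ℕ} (i : Fin n) (X Y : Fin n → Matrix (Fin 2) (Fin 2) ℂ)
    (hi : X i = -Y i) (h : ∀ k, k ≠ i → X k = Y k) : tensor X = -tensor Y := by
  ext x y
  simp only [tensor, Matrix.of_apply, Matrix.neg_apply]
  rw [← Finset.mul_prod_erase _ _ (Finset.mem_univ i),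
    ← Finset.mul_prod_erase Finset.univ (fun k => Y k (x k) (y k)) (Finset.mem_univ i), hi,
    Finset.prod_congr rfl fun k hk => by rw [h k (Finset.ne_of_mem_erase hk)]]
  simp

theorem qMat_sq : qMat * qMat = 1 := by
  ext a b; fin_cases a <;> fin_cases b <;> simp [qMat]

theorem uMat_sq : uMat * uMat = 1 := by
  ext a b; fin_cases a <;> fin_cases b <;> simp [uMat]

theorem qMat_mul_uMat : qMat * uMat = -(uMat * qMat) := by
  ext a b; fin_cases a <;> fin_cases b <;> simp [uMat, qMat]

theorem gen_isHermitian {n : ℕ} (j : Fin n) : (gen j).IsHermitian := by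
  ext x y
  simp only [gen, tensor, Matrix.conjTranspose_apply, Matrix.of_apply, star_prod]
  refine Finset.prod_congr rfl fun i _ => ?_
  generalize x i = a
  generalize y i = b
  split_ifs
  · fin_cases a <;> fin_cases b <;> simp [uMat]
  · fin_cases a <;> fin_cases b <;> simp [qMat]
  · fin_cases a <;> fin_cases b <;> simp

theorem gen_sq {n : ℕ} (j : Fin n) : gen j * gen j = 1 := by
  rw [gen, tensor_mul, ← tensor_one]
  congr 1
  funext i
  split_ifs <;> simp [uMat_sq, qMat_sq]

theorem gen_anticomm_of_lt {n : ℕ} {i j : Fin n} (h : i < j) :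
    gen i * gen j = -(gen j * gen i) := by
  rw [gen, gen, tensor_mul, tensor_mul]
  refine tensor_neg i _ _ (by simp [h, qMat_mul_uMat]) fun k hk => ?_
  rcases lt_or_gt_of_ne hk with hk | hk
  · simp [hk, hk.trans h]
  · simp [hk.not_gt, hk.ne']

theorem gen_anticomm {n : ℕ} {i j : Fin n} (h : i ≠ j) :
    gen i * gen j = -(gen j * gen i) := by
  rcases lt_or_gt_of_ne h with h | h
  · exact gen_anticomm_of_lt h
  · rw [gen_anticomm_of_lt h, neg_neg]

/-- The canonical anticommutation relations. -/
theorem car {n : ℕ} (i j : Fin n) :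
    gen i * gen j + gen j * gen i = if i = j then 2 else 0 := by
  split_ifs with h
  · subst h; rw [gen_sq]; norm_num
  · rw [gen_anticomm h]; simp

theorem grading_mul {n : ℕ} (A B : Op n) : grading (A * B) = grading A * grading B := by
  have h : tensor (fun _ : Fin n => uMat) * tensor (fun _ : Fin n => uMat) = 1 := by
    rw [tensor_mul]; simp only [uMat_sq]; exact tensor_one
  simp only [grading]
  calc _ = tensor (fun _ => uMat) * A * 1 * B * tensor (fun _ => uMat) := by simp [mul_assoc]
    _ = _ := by rw [← h]; simp only [mul_assoc]

theorem grading_one {n : ℕ} : grading (1 : Op n) = 1 := by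
  rw [grading, mul_one, tensor_mul]; simp only [uMat_sq]; exact tensor_one

theorem grading_gen {n : ℕ} (j : Fin n) : grading (gen j) = -gen j := by
  rw [grading, gen, tensor_mul, tensor_mul]
  refine tensor_neg j _ _ ?_ fun k hk => ?_
  · simp only [lt_irrefl, if_false, if_true]
    rw [mul_assoc, qMat_mul_uMat, mul_neg, ← mul_assoc, uMat_sq, one_mul]
  · split_ifs <;> simp [uMat_sq]

theorem grading_list {n : ℕ} (α : Fin n → Fin 2) (l : List (Fin n)) :
    grading (l.map fun j => gen j ^ (α j : ℕ)).prod =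
      (-1 : ℂ) ^ (l.map fun j => (α j : ℕ)).sum • (l.map fun j => gen j ^ (α j : ℕ)).prod := by
  induction l with
  | nil => simp [grading_one]
  | cons j l ih =>
    have hj : grading (gen j ^ (α j : ℕ)) = (-1 : ℂ) ^ (α j : ℕ) • gen j ^ (α j : ℕ) := by
      generalize α j = a
      fin_cases a <;> simp [grading_one, grading_gen]
    simp only [List.map_cons, List.prod_cons, List.sum_cons, grading_mul, hj, ih, pow_add,
      smul_mul_smul_comm]

theorem list_mul_gen {n : ℕ} (α : Fin n → Fin 2) (i : Fin n) (l : List (Fin n)) :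
    (l.map fun j => gen j ^ (α j : ℕ)).prod * gen i =
      (-1 : ℂ) ^ (l.map fun j => if j = i then 0 else (α j : ℕ)).sum •
        (gen i * (l.map fun j => gen j ^ (α j : ℕ)).prod) := by
  induction l with
  | nil => simp
  | cons j l ih =>
    have hj : gen j ^ (α j : ℕ) * gen i =
        (-1 : ℂ) ^ (if j = i then 0 else (α j : ℕ)) • (gen i * gen j ^ (α j : ℕ)) := by
      generalize α j = a
      split_ifs with h
      · subst h; fin_cases a <;> simp
      · fin_cases a <;> simp [gen_anticomm h]
    simp only [List.map_cons, List.prod_cons, List.sum_cons, mul_assoc, ih, pow_add]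
    rw [mul_smul_comm, ← mul_assoc, hj, smul_mul_assoc, smul_smul, mul_assoc, mul_comm]

/-- `Γ(Q^α) = (-1)^{|α|} Q^α`. -/
theorem grading_monomial {n : ℕ} (α : Fin n → Fin 2) :
    grading (monomial α) = (-1 : ℂ) ^ (∑ j, (α j : ℕ)) • monomial α := by
  have := grading_list α (List.finRange n)
  rwa [← List.ofFn_eq_map, ← List.ofFn_eq_map, List.sum_ofFn] at this

theorem monomial_mul_gen {n : ℕ} (α : Fin n → Fin 2) (i : Fin n) :
    monomial α * gen i =
      (-1 : ℂ) ^ (∑ j, if j = i then 0 else (α j : ℕ)) • (gen i * monomial α) := by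
  have := list_mul_gen α i (List.finRange n)
  rwa [← List.ofFn_eq_map, ← List.ofFn_eq_map, List.sum_ofFn] at this

theorem grading_monomial_mul_gen {n : ℕ} (α : Fin n → Fin 2) (i : Fin n) :
    grading (monomial α) * gen i = (-1 : ℂ) ^ (α i : ℕ) • (gen i * monomial α) := by
  rw [grading_monomial, smul_mul_assoc, monomial_mul_gen, smul_smul]
  congr 1
  have h : ∑ j, (α j : ℕ) = α i + ∑ j, if j = i then 0 else (α j : ℕ) := by
    have : ∀ j, (α j : ℕ) = (if j = i then (α i : ℕ) else 0) + if j = i then 0 else (α j : ℕ) := by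
      intro j; split_ifs with hj <;> simp [hj]
    rw [Finset.sum_congr rfl fun j _ => this j, Finset.sum_add_distrib]
    simp
  rw [h, pow_add, mul_assoc, ← mul_pow]
  simp

/-- `∇_i Q^α` is `Q_i Q^α` if `α_i = 1` and `0` if `α_i = 0`. -/
theorem partialD_monomial {n : ℕ} (i : Fin n) (α : Fin n → Fin 2) :
    partialD i (monomial α) = if α i = 1 then gen i * monomial α else 0 := by
  rw [partialD, grading_monomial_mul_gen]
  generalize α i = a
  fin_cases a
  · simp
  · simp [← two_smul ℂ, smul_smul]

/-- `∇_i^* Q^α` is `0` if `α_i = 1` and `Q_i Q^α` if `α_i = 0`. -/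
theorem partialDAdj_monomial {n : ℕ} (i : Fin n) (α : Fin n → Fin 2) :
    partialDAdj i (monomial α) = if α i = 1 then 0 else gen i * monomial α := by
  rw [partialDAdj, grading_monomial_mul_gen]
  generalize α i = a
  fin_cases a
  · simp [← two_smul ℂ, smul_smul]
  · simp

/-- `∇_i^*` is the adjoint of `∇_i` for the inner product `⟨A, B⟩ = τ(A^* B)`. -/
theorem tau_partialD {n : ℕ} (i : Fin n) (A B : Op n) :
    tau ((partialD i A)ᴴ * B) = tau (Aᴴ * partialDAdj i B) := by
  have hu : (tensor (fun _ : Fin n => uMat))ᴴ = tensor (fun _ : Fin n => uMat) := by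
    ext x y
    simp only [tensor, Matrix.conjTranspose_apply, Matrix.of_apply, star_prod]
    refine Finset.prod_congr rfl fun k _ => ?_
    generalize x k = a
    generalize y k = b
    fin_cases a <;> fin_cases b <;> simp [uMat]
  have hg : gen i * tensor (fun _ => uMat) = -(tensor (fun _ => uMat) * gen i) := by
    have h1 : tensor (fun _ : Fin n => uMat) * tensor (fun _ : Fin n => uMat) = 1 := by
      rw [tensor_mul]; simp only [uMat_sq]; exact tensor_one
    have h2 := grading_gen i
    rw [grading] at h2
    calc _ = tensor (fun _ => uMat) * (tensor (fun _ => uMat) * gen i * tensor (fun _ => uMat)) := by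
          simp only [← mul_assoc, h1, one_mul]
      _ = _ := by rw [h2, mul_neg]
  have hq : (gen i)ᴴ = gen i := gen_isHermitian i
  have hq2 : tensor (fun _ => uMat) * gen i = -(gen i * tensor (fun _ => uMat)) := by
    rw [hg, neg_neg]
  unfold tau partialD partialDAdj grading
  congr 1
  simp only [Matrix.conjTranspose_smul, Matrix.conjTranspose_sub, Matrix.conjTranspose_mul, hq, hu,
    smul_mul_assoc, mul_smul_comm, Matrix.trace_smul, sub_mul, mul_add, Matrix.trace_sub,
    Matrix.trace_add]
  have key : (gen i * (tensor (fun _ => uMat) * (Aᴴ * tensor (fun _ => uMat))) * B).trace =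
      -(Aᴴ * (tensor (fun _ => uMat) * B * tensor (fun _ => uMat) * gen i)).trace := by
    rw [mul_assoc, mul_assoc, mul_assoc, ← mul_assoc, Matrix.trace_mul_comm, hg]
    simp [mul_assoc, hq2]
  rw [key]
  simp [mul_assoc]

end FermiClifford

/-!
The distance is bounded by the length of one explicit curve, the orbit of `ρ` under the fermionic
Mehler semigroup `e^{-tN}`, `N = -div ∇`. In the given matrix representation `e^{-tN}` multiplies the
entry at `(x, y)` by `r ^ d(x, y)`, where `d` is the Hamming distance and `r = e^{-t}`; it is the
operator `mehler r`. So `t ↦ mehler (1 - t) ρ` is polynomial in `t`, and it ends at the identity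
because the diagonal of an element of the Clifford algebra is constant (`mehler_zero`).

* By the chain rule `(Γ(ρ), ρ) # ∇ log ρ = ∇ρ` (`sharp_partialD_log`) the orbit is the gradient flow
  of the entropy, and its squared speed is the Fisher information `I(ρ) = τ(log ρ · Nρ)`
  (`metric_smul_numberOp`). The entropy has derivative `I / r` along `mehler r ρ`
  (`hasDerivWithinAt_entropy_mehler`), by Klein's inequality and continuity of the logarithm.
* The Fisher information decays: `I(mehler r ρ) ≤ r ^ 2 I(ρ)` (`fisher_mehler_le`). The factor
  `r ^ 2` comes from `∇_i (mehler r ρ) = r mehler r (∇_i ρ)` (`partialD_mehler`). For the rest,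
  `G ∇_i` is the inner derivation by `½ G Q_i`, with `G` the grading operator, and `mehler r` is a
  mixture of conjugations by diagonal sign operators (`mehler_eq_mixture`). The identity
  `(log b - log a) / (b - a) = ∫₀¹ dx / ((1 - x) a + x b)` writes `I` as an integral of forms
  `⟪C, X⁻¹ C⟫` with `X` affine in `ρ`; each is a supremum of affine functionals of `(ρ, C)`, so it
  does not increase under such mixtures (`commForm_mixture_le`).
* Hence the speed `k(r) = √I / r` of `mehler r ρ` is nondecreasing in `r`, so `L(r) = ∫₀ʳ k` is at
  most `r k(r)` and `(L ^ 2)' = 2 L k ≤ 2 r k ^ 2 = 2 S'`. Integrating over `[0, 1]` gives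
  `L(1) ^ 2 ≤ 2 S(ρ)` (`integral_le_sqrt_of_monotoneOn`).
-/

namespace FermiClifford

/-! ### Spectral calculus of positive definite matrices -/

section Spectral

variable {ι : Type*} [Fintype ι] [DecidableEq ι]

/-- `A = V diag(b) Vᴴ` with `V` unitary and `b > 0`, together with the resulting formula for the
functional calculus of `A`. -/
structure Diagonalizes (A V : Matrix ι ι ℂ) (b : ι → ℝ) : Prop where
  left : Vᴴ * V = 1
  right : V * Vᴴ = 1
  pos : ∀ i, 0 < b i
  cfc_eq : ∀ f : ℝ → ℝ, cfc f A = V * Matrix.diagonal (fun i => ((f (b i) : ℝ) : ℂ)) * Vᴴ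
  eq : A = V * Matrix.diagonal (fun i => ((b i : ℝ) : ℂ)) * Vᴴ

theorem exists_diagonalizes {A : Matrix ι ι ℂ} (hA : A.PosDef) :
    ∃ V b, Diagonalizes A V b := by
  refine ⟨hA.1.eigenvectorUnitary, hA.1.eigenvalues, ?_, ?_, hA.eigenvalues_pos, ?_, ?_⟩
  · rw [← Matrix.star_eq_conjTranspose]; exact Unitary.coe_star_mul_self _
  · rw [← Matrix.star_eq_conjTranspose]; exact Unitary.coe_mul_star_self _
  · intro f
    rw [hA.1.cfc_eq, Matrix.IsHermitian.cfc, Unitary.conjStarAlgAut_apply]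
    rfl
  · conv_lhs => rw [hA.1.spectral_theorem, Unitary.conjStarAlgAut_apply]
    rfl

namespace Diagonalizes

variable {A V : Matrix ι ι ℂ} {b : ι → ℝ} (D : Diagonalizes A V b)
include D

theorem frame_mul (X Y : Matrix ι ι ℂ) : Vᴴ * (X * Y) * V = (Vᴴ * X * V) * (Vᴴ * Y * V) := by
  calc _ = Vᴴ * X * 1 * Y * V := by simp [mul_assoc]
    _ = _ := by rw [← D.right]; simp only [mul_assoc]

theorem frame_cfc (f : ℝ → ℝ) :
    Vᴴ * cfc f A * V = Matrix.diagonal (fun i => ((f (b i) : ℝ) : ℂ)) := by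
  rw [D.cfc_eq]
  simp only [mul_assoc, D.left, mul_one]
  rw [← mul_assoc, D.left, one_mul]

theorem frame_self : Vᴴ * A * V = Matrix.diagonal (fun i => ((b i : ℝ) : ℂ)) := by
  conv_lhs => rw [D.eq]
  simp only [mul_assoc, D.left, mul_one]
  rw [← mul_assoc, D.left, one_mul]

theorem trace_frame (X : Matrix ι ι ℂ) : (Vᴴ * X * V).trace = X.trace := by
  rw [Matrix.trace_mul_comm, ← mul_assoc, D.right, one_mul]

/-- The Hilbert-Schmidt inner product in the eigenbasis. -/
theorem trace_conjTranspose_mul (X Y : Matrix ι ι ℂ) :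
    (Xᴴ * Y).trace = ∑ k, ∑ l, star ((Vᴴ * X * V) k l) * (Vᴴ * Y * V) k l := by
  rw [← D.trace_frame, D.frame_mul]
  have : Vᴴ * Xᴴ * V = (Vᴴ * X * V)ᴴ := by simp [mul_assoc]
  rw [this, Finset.sum_comm, Matrix.trace]
  simp only [Matrix.diag_apply, Matrix.mul_apply (M := (_)ᴴ) (N := Vᴴ * Y * V),
    Matrix.conjTranspose_apply]

theorem frame_commutator_cfc (f : ℝ → ℝ) (M : Matrix ι ι ℂ) (k l : ι) :
    (Vᴴ * (M * cfc f A - cfc f A * M) * V) k l =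
      (Vᴴ * M * V) k l * ((f (b l) - f (b k) : ℝ) : ℂ) := by
  rw [mul_sub, sub_mul, D.frame_mul, D.frame_mul, D.frame_cfc, Matrix.sub_apply,
    Matrix.mul_diagonal, Matrix.diagonal_mul]
  push_cast; ring

theorem frame_commutator (M : Matrix ι ι ℂ) (k l : ι) :
    (Vᴴ * (M * A - A * M) * V) k l = (Vᴴ * M * V) k l * ((b l - b k : ℝ) : ℂ) := by
  rw [mul_sub, sub_mul, D.frame_mul, D.frame_mul, D.frame_self, Matrix.sub_apply,
    Matrix.mul_diagonal, Matrix.diagonal_mul]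
  push_cast; ring

end Diagonalizes

/-! ### The Dirichlet form of a commutator against the logarithm -/

/-- The Fisher information `Re tr([M, log A]ᴴ [M, A])` of `A` in the direction of the derivation
`[M, ·]`. -/
noncomputable def commForm (A M : Matrix ι ι ℂ) : ℝ :=
  ((M * cfc Real.log A - cfc Real.log A * M)ᴴ * (M * A - A * M)).trace.re

/-- Each term has the sign of `(log b_l - log b_k) (b_l - b_k) ≥ 0`. -/
theorem Diagonalizes.commForm_eq {A V : Matrix ι ι ℂ} {b : ι → ℝ} (D : Diagonalizes A V b)
    (M : Matrix ι ι ℂ) :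
    commForm A M = ∑ k, ∑ l, Complex.normSq ((Vᴴ * M * V) k l) *
      ((Real.log (b l) - Real.log (b k)) * (b l - b k)) := by
  rw [commForm, D.trace_conjTranspose_mul, Complex.re_sum]
  refine Finset.sum_congr rfl fun k _ => ?_
  rw [Complex.re_sum]
  refine Finset.sum_congr rfl fun l _ => ?_
  rw [D.frame_commutator_cfc, D.frame_commutator]
  generalize (Vᴴ * M * V) k l = z
  simp [Complex.normSq_apply, -Complex.ofReal_sub]
  ring

theorem commForm_nonneg {A : Matrix ι ι ℂ} (hA : A.PosDef) (M : Matrix ι ι ℂ) :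
    0 ≤ commForm A M := by
  obtain ⟨V, b, D⟩ := exists_diagonalizes hA
  rw [D.commForm_eq]
  refine Finset.sum_nonneg fun k _ => Finset.sum_nonneg fun l _ =>
    mul_nonneg (Complex.normSq_nonneg _) ?_
  rcases le_total (b k) (b l) with h | h
  · exact mul_nonneg (sub_nonneg.2 (Real.log_le_log (D.pos k) h)) (sub_nonneg.2 h)
  · exact mul_nonneg_of_nonpos_of_nonpos
      (sub_nonpos.2 (Real.log_le_log (D.pos l) h)) (sub_nonpos.2 h)

/-- The concave quadratic functional of `W` whose maximum is `⟪C, X⁻¹ C⟫` for the positive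
superoperator `X W = (1 - x) A W + x W A`. It is affine in `(A, C)`. -/
noncomputable def resolventForm (x : ℝ) (A C W : Matrix ι ι ℂ) : ℝ :=
  2 * (Wᴴ * C).trace.re - (1 - x) * (Wᴴ * (A * W)).trace.re - x * (Wᴴ * (W * A)).trace.re

/-- `⟪C, X⁻¹ C⟫` for `X W = (1 - x) A W + x W A`, written in an eigenbasis `V` of `A` with
eigenvalues `b`. -/
noncomputable def resolventSum (V : Matrix ι ι ℂ) (b : ι → ℝ) (x : ℝ) (C : Matrix ι ι ℂ) : ℝ :=
  ∑ k, ∑ l, Complex.normSq ((Vᴴ * C * V) k l) / ((1 - x) * b k + x * b l)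

theorem weighted_pos {a b x : ℝ} (ha : 0 < a) (hb : 0 < b) (hx : x ∈ Set.Icc (0 : ℝ) 1) :
    0 < (1 - x) * a + x * b := by
  rcases eq_or_lt_of_le hx.1 with h | h
  · simpa [← h] using ha
  · exact add_pos_of_nonneg_of_pos (mul_nonneg (sub_nonneg.2 hx.2) ha.le) (mul_pos h hb)

namespace Diagonalizes

variable {A V : Matrix ι ι ℂ} {b : ι → ℝ} (D : Diagonalizes A V b)
include D

theorem resolventForm_eq (x : ℝ) (C W : Matrix ι ι ℂ) :
    resolventForm x A C W = ∑ k, ∑ l,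
      (2 * (star ((Vᴴ * W * V) k l) * (Vᴴ * C * V) k l).re -
        ((1 - x) * b k + x * b l) * Complex.normSq ((Vᴴ * W * V) k l)) := by
  rw [resolventForm, D.trace_conjTranspose_mul, D.trace_conjTranspose_mul,
    D.trace_conjTranspose_mul, D.frame_mul, D.frame_mul, D.frame_self]
  simp only [Complex.re_sum, Finset.mul_sum, ← Finset.sum_sub_distrib]
  refine Finset.sum_congr rfl fun k _ => Finset.sum_congr rfl fun l _ => ?_
  rw [Matrix.mul_diagonal, Matrix.diagonal_mul]
  generalize (Vᴴ * W * V) k l = z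
  simp [Complex.normSq_apply]
  ring

theorem resolventForm_le {x : ℝ} (hx : x ∈ Set.Icc (0 : ℝ) 1) (C W : Matrix ι ι ℂ) :
    resolventForm x A C W ≤ resolventSum V b x C := by
  rw [D.resolventForm_eq]
  refine Finset.sum_le_sum fun k _ => Finset.sum_le_sum fun l _ => ?_
  have hp := weighted_pos (D.pos k) (D.pos l) hx
  generalize (1 - x) * b k + x * b l = p at hp
  generalize (Vᴴ * W * V) k l = w
  generalize (Vᴴ * C * V) k l = c
  rw [le_div_iff₀ hp]
  have h := Complex.normSq_nonneg (c - p * w)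
  simp only [Complex.normSq_apply, Complex.sub_re, Complex.sub_im, Complex.mul_re, Complex.mul_im,
    Complex.ofReal_re, Complex.ofReal_im, Complex.star_def, Complex.conj_re, Complex.conj_im] at h ⊢
  nlinarith [h]

theorem exists_resolventForm_eq {x : ℝ} (hx : x ∈ Set.Icc (0 : ℝ) 1) (C : Matrix ι ι ℂ) :
    ∃ W, resolventForm x A C W = resolventSum V b x C := by
  -- The maximiser solves `(1 - x) A W + x W A = C`.
  let w : Matrix ι ι ℂ :=
    Matrix.of fun k l => (((1 - x) * b k + x * b l)⁻¹ : ℝ) * (Vᴴ * C * V) k l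
  refine ⟨V * w * Vᴴ, ?_⟩
  have hw : Vᴴ * (V * w * Vᴴ) * V = w := by
    simp only [mul_assoc, D.left, mul_one]
    rw [← mul_assoc, D.left, one_mul]
  rw [D.resolventForm_eq, hw]
  refine Finset.sum_congr rfl fun k _ => Finset.sum_congr rfl fun l _ => ?_
  have hp := weighted_pos (D.pos k) (D.pos l) hx
  simp only [w, Matrix.of_apply]
  generalize (1 - x) * b k + x * b l = p at hp
  generalize (Vᴴ * C * V) k l = c
  simp only [Complex.normSq_apply, Complex.mul_re, Complex.mul_im, star_mul', Complex.star_def,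
    Complex.conj_re, Complex.conj_im, Complex.ofReal_re, Complex.ofReal_im, Complex.conj_ofReal]
  field_simp
  ring

omit D in
theorem integral_inv_weighted {a b : ℝ} (ha : 0 < a) (hb : 0 < b) :
    ∫ x in (0 : ℝ)..1, (b - a) ^ 2 / ((1 - x) * a + x * b) =
      (Real.log b - Real.log a) * (b - a) := by
  have hpos : ∀ x ∈ Set.uIcc (0 : ℝ) 1, (1 - x) * a + x * b ≠ 0 := fun x hx =>
    (weighted_pos ha hb (by rwa [Set.uIcc_of_le zero_le_one] at hx)).ne'
  have hd : ∀ x ∈ Set.uIcc (0 : ℝ) 1, HasDerivAt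
      (fun x => (b - a) * Real.log ((1 - x) * a + x * b))
      ((b - a) ^ 2 / ((1 - x) * a + x * b)) x := by
    intro x hx
    have h1 : HasDerivAt (fun x : ℝ => (1 - x) * a + x * b) (b - a) x := by
      have := (((hasDerivAt_id x).const_sub 1).mul_const a).add ((hasDerivAt_id x).mul_const b)
      exact this.congr_deriv (by ring)
    have := (h1.log (hpos x hx)).const_mul (b - a)
    exact this.congr_deriv (by ring)
  rw [intervalIntegral.integral_eq_sub_of_hasDerivAt hd]
  · simp; ring
  · refine ContinuousOn.intervalIntegrable ?_
    exact ContinuousOn.div (by fun_prop) (by fun_prop) hpos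

theorem continuousOn_resolventSum (C : Matrix ι ι ℂ) :
    ContinuousOn (fun x => resolventSum V b x C) (Set.uIcc 0 1) := by
  unfold resolventSum
  refine continuousOn_finsetSum _ fun k _ => continuousOn_finsetSum _ fun l _ =>
    ContinuousOn.div (by fun_prop) (by fun_prop) fun x hx => ?_
  rw [Set.uIcc_of_le zero_le_one] at hx
  exact (weighted_pos (D.pos k) (D.pos l) hx).ne'

/-- The Fisher information is a superposition of the jointly convex forms `⟪C, X⁻¹ C⟫`. -/
theorem commForm_eq_integral (M : Matrix ι ι ℂ) :
    commForm A M = ∫ x in (0 : ℝ)..1, resolventSum V b x (M * A - A * M) := by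
  rw [D.commForm_eq]
  unfold resolventSum
  have hI : ∀ k l, IntervalIntegrable (fun x : ℝ =>
      Complex.normSq ((Vᴴ * (M * A - A * M) * V) k l) / ((1 - x) * b k + x * b l))
      MeasureTheory.volume 0 1 := fun k l => by
    refine (ContinuousOn.div (by fun_prop) (by fun_prop) fun x hx => ?_).intervalIntegrable
    rw [Set.uIcc_of_le zero_le_one] at hx
    exact (weighted_pos (D.pos k) (D.pos l) hx).ne'
  rw [intervalIntegral.integral_finsetSum fun k _ => by
    simpa only [Finset.sum_fn] using IntervalIntegrable.sum Finset.univ fun l _ => hI k l]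
  refine Finset.sum_congr rfl fun k _ => ?_
  rw [intervalIntegral.integral_finsetSum fun l _ => hI k l]
  refine Finset.sum_congr rfl fun l _ => ?_
  rw [← integral_inv_weighted (D.pos k) (D.pos l), ← intervalIntegral.integral_const_mul]
  refine intervalIntegral.integral_congr fun x _ => ?_
  simp only [D.frame_commutator, Complex.normSq_mul, Complex.normSq_ofReal]
  ring

end Diagonalizes

/-- The mixture `X ↦ ∑ s, w s • U s X (U s)ᴴ` of conjugations. -/
noncomputable def mixture {σ : Type*} (S : Finset σ) (w : σ → ℝ) (U : σ → Matrix ι ι ℂ)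
    (X : Matrix ι ι ℂ) : Matrix ι ι ℂ :=
  ∑ s ∈ S, (w s : ℂ) • (U s * X * (U s)ᴴ)

/-- Under a mixture of unitary conjugations the maximum of `resolventForm` does not increase: a
maximiser for the mixture, conjugated back, is a competitor in every term. -/
theorem resolventSum_mixture_le {σ : Type*} {S : Finset σ} {w : σ → ℝ} {U : σ → Matrix ι ι ℂ}
    (hw : ∀ s ∈ S, 0 ≤ w s) (hw1 : ∑ s ∈ S, w s = 1) (hU : ∀ s ∈ S, U s * (U s)ᴴ = 1)
    {A V V' C : Matrix ι ι ℂ} {b b' : ι → ℝ} (D : Diagonalizes A V b)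
    (D' : Diagonalizes (mixture S w U A) V' b') {x : ℝ} (hx : x ∈ Set.Icc (0 : ℝ) 1) :
    resolventSum V' b' x (mixture S w U C) ≤ resolventSum V b x C := by
  obtain ⟨W, hW⟩ := D'.exists_resolventForm_eq hx (mixture S w U C)
  have key : resolventForm x (mixture S w U A) (mixture S w U C) W =
      ∑ s ∈ S, w s * resolventForm x A C ((U s)ᴴ * W * U s) := by
    have e1 : ∀ s ∈ S, (((U s)ᴴ * W * U s)ᴴ * C).trace = (Wᴴ * (U s * C * (U s)ᴴ)).trace := by
      intro s _
      rw [show ((U s)ᴴ * W * U s)ᴴ * C = (U s)ᴴ * (Wᴴ * U s * C) by simp [mul_assoc],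
        Matrix.trace_mul_comm]
      simp only [mul_assoc]
    have e2 : ∀ s ∈ S, (((U s)ᴴ * W * U s)ᴴ * (A * ((U s)ᴴ * W * U s))).trace =
        (Wᴴ * (U s * A * (U s)ᴴ * W)).trace := by
      intro s hs
      rw [show ((U s)ᴴ * W * U s)ᴴ * (A * ((U s)ᴴ * W * U s)) =
          (U s)ᴴ * (Wᴴ * U s * A * (U s)ᴴ * W * U s) by simp [mul_assoc],
        Matrix.trace_mul_comm, mul_assoc _ (U s) (U s)ᴴ, hU s hs]
      simp only [mul_assoc, mul_one]
    have e3 : ∀ s ∈ S, (((U s)ᴴ * W * U s)ᴴ * ((U s)ᴴ * W * U s * A)).trace =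
        (Wᴴ * (W * (U s * A * (U s)ᴴ))).trace := by
      intro s hs
      rw [show ((U s)ᴴ * W * U s)ᴴ * ((U s)ᴴ * W * U s * A) =
          (U s)ᴴ * (Wᴴ * (U s * (U s)ᴴ) * W * U s * A) by simp [mul_assoc],
        Matrix.trace_mul_comm, hU s hs]
      simp only [mul_assoc, mul_one]
    unfold resolventForm mixture
    simp only [Finset.mul_sum, Finset.sum_mul, Matrix.trace_sum, Complex.re_sum,
      mul_smul_comm, smul_mul_assoc, Matrix.trace_smul, smul_eq_mul, Complex.re_ofReal_mul,
      ← Finset.sum_sub_distrib]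
    refine Finset.sum_congr rfl fun s hs => ?_
    rw [e1 s hs, e2 s hs, e3 s hs]
    ring
  rw [← hW, key]
  calc _ ≤ ∑ s ∈ S, w s * resolventSum V b x C :=
        Finset.sum_le_sum fun s hs => mul_le_mul_of_nonneg_left (D.resolventForm_le hx _ _) (hw s hs)
    _ = _ := by rw [← Finset.sum_mul, hw1, one_mul]

/-- A mixture of unitary conjugations that intertwines the derivation `[M, ·]` up to a factor `r`
contracts the Fisher information by `r ^ 2`. -/
theorem commForm_mixture_le {σ : Type*} {S : Finset σ} {w : σ → ℝ} {U : σ → Matrix ι ι ℂ}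
    (hw : ∀ s ∈ S, 0 ≤ w s) (hw1 : ∑ s ∈ S, w s = 1) (hU : ∀ s ∈ S, U s * (U s)ᴴ = 1)
    {A M : Matrix ι ι ℂ} (hA : A.PosDef) (hA' : (mixture S w U A).PosDef) {r : ℝ}
    (h : M * mixture S w U A - mixture S w U A * M = (r : ℂ) • mixture S w U (M * A - A * M)) :
    commForm (mixture S w U A) M ≤ r ^ 2 * commForm A M := by
  obtain ⟨V, b, D⟩ := exists_diagonalizes hA
  obtain ⟨V', b', D'⟩ := exists_diagonalizes hA'
  rw [D.commForm_eq_integral, D'.commForm_eq_integral, ← intervalIntegral.integral_const_mul]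
  refine intervalIntegral.integral_mono_on zero_le_one
    (D'.continuousOn_resolventSum _).intervalIntegrable
    ((D.continuousOn_resolventSum _).const_smul (r ^ 2)).intervalIntegrable fun x hx => ?_
  have h2 : resolventSum V' b' x ((r : ℂ) • mixture S w U (M * A - A * M)) =
      r ^ 2 * resolventSum V' b' x (mixture S w U (M * A - A * M)) := by
    simp only [resolventSum, Finset.mul_sum, mul_smul_comm, smul_mul_assoc, Matrix.smul_apply,
      smul_eq_mul, Complex.normSq_mul, Complex.normSq_ofReal]
    refine Finset.sum_congr rfl fun k _ => Finset.sum_congr rfl fun l _ => ?_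
    ring
  rw [h, h2]
  exact mul_le_mul_of_nonneg_left (resolventSum_mixture_le hw hw1 hU D D' hx) (sq_nonneg r)

/-! ### Klein's inequality -/

theorem trace_diag_mul_diag {V W : Matrix ι ι ℂ} (f g : ι → ℝ) :
    ((V * Matrix.diagonal (fun i => (f i : ℂ)) * Vᴴ) *
      (W * Matrix.diagonal (fun i => (g i : ℂ)) * Wᴴ)).trace.re =
      ∑ k, ∑ l, Complex.normSq ((Vᴴ * W) k l) * (f k * g l) := by
  have h1 : ((V * Matrix.diagonal (fun i => (f i : ℂ)) * Vᴴ) *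
      (W * Matrix.diagonal (fun i => (g i : ℂ)) * Wᴴ)).trace =
      (Matrix.diagonal (fun i => (f i : ℂ)) * (Vᴴ * W) *
        (Matrix.diagonal (fun i => (g i : ℂ)) * (Vᴴ * W)ᴴ)).trace := by
    rw [Matrix.conjTranspose_mul, Matrix.conjTranspose_conjTranspose]
    simp only [mul_assoc]
    rw [Matrix.trace_mul_comm]
    simp only [mul_assoc]
  rw [h1, Matrix.trace]
  simp only [Matrix.diag_apply, Matrix.mul_apply (M := _ * _), Matrix.diagonal_mul,
    Matrix.conjTranspose_apply, Complex.re_sum]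
  refine Finset.sum_congr rfl fun k _ => Finset.sum_congr rfl fun l _ => ?_
  generalize (Vᴴ * W) k l = z
  simp [Complex.normSq_apply]
  ring

theorem klein_scalar {a b : ℝ} (ha : 0 < a) (hb : 0 < b) :
    a - b ≤ a * (Real.log a - Real.log b) := by
  have h := Real.log_le_sub_one_of_pos (div_pos hb ha)
  rw [Real.log_div hb.ne' ha.ne'] at h
  have := mul_le_mul_of_nonneg_left h ha.le
  have e : a * (b / a - 1) = b - a := by field_simp
  nlinarith

/-- Klein's inequality: the relative entropy of positive matrices is nonnegative, up to the
difference of the traces. -/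
theorem klein {A B : Matrix ι ι ℂ} (hA : A.PosDef) (hB : B.PosDef) :
    (A - B).trace.re ≤ (A * cfc Real.log A).trace.re - (A * cfc Real.log B).trace.re := by
  obtain ⟨V, a, D⟩ := exists_diagonalizes hA
  obtain ⟨W, b, E⟩ := exists_diagonalizes hB
  have one_V : V * Matrix.diagonal (fun _ => ((1 : ℝ) : ℂ)) * Vᴴ = 1 := by simp [D.right]
  have one_W : W * Matrix.diagonal (fun _ => ((1 : ℝ) : ℂ)) * Wᴴ = 1 := by simp [E.right]
  have t1 : (A * cfc Real.log A).trace.re =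
      ∑ k, ∑ l, Complex.normSq ((Vᴴ * W) k l) * ((a k * Real.log (a k)) * 1) := by
    rw [← trace_diag_mul_diag, one_W, mul_one]
    congr 2
    rw [D.cfc_eq]
    conv_lhs => enter [1]; rw [D.eq]
    have : V * Matrix.diagonal (fun i => (a i : ℂ)) * Vᴴ *
        (V * Matrix.diagonal (fun i => (Real.log (a i) : ℂ)) * Vᴴ) =
        V * Matrix.diagonal (fun i => (a i : ℂ)) * (Vᴴ * V) *
        Matrix.diagonal (fun i => (Real.log (a i) : ℂ)) * Vᴴ := by simp only [mul_assoc]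
    rw [this, D.left, mul_one, mul_assoc V, Matrix.diagonal_mul_diagonal]
    simp only [Complex.ofReal_mul]
  have t2 : (A * cfc Real.log B).trace.re =
      ∑ k, ∑ l, Complex.normSq ((Vᴴ * W) k l) * (a k * Real.log (b l)) := by
    rw [← trace_diag_mul_diag, E.cfc_eq, ← D.eq]
  have t3 : A.trace.re = ∑ k, ∑ l, Complex.normSq ((Vᴴ * W) k l) * (a k * 1) := by
    rw [← trace_diag_mul_diag, one_W, mul_one, ← D.eq]
  have t4 : B.trace.re = ∑ k, ∑ l, Complex.normSq ((Vᴴ * W) k l) * (1 * b l) := by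
    rw [← trace_diag_mul_diag, one_V, one_mul, ← E.eq]
  rw [Matrix.trace_sub, Complex.sub_re, t1, t2, t3, t4]
  simp only [← Finset.sum_sub_distrib]
  refine Finset.sum_le_sum fun k _ => Finset.sum_le_sum fun l _ => ?_
  have := mul_le_mul_of_nonneg_left (klein_scalar (D.pos k) (E.pos l))
    (Complex.normSq_nonneg ((Vᴴ * W) k l))
  nlinarith

end Spectral

/-! ### Multiplication by a density and the chain rule -/

theorem cfc_conj {ι : Type*} [Fintype ι] [DecidableEq ι] {A U : Matrix ι ι ℂ}
    (hU : U ∈ Matrix.unitaryGroup ι ℂ) (hA : A.IsHermitian) (f : ℝ → ℝ) :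
    cfc f (U * A * Uᴴ) = U * cfc f A * Uᴴ := by
  have hfin : (spectrum ℝ A).Finite := by
    rw [hA.spectrum_real_eq_range_eigenvalues]; exact Set.finite_range _
  let φ := Unitary.conjStarAlgAut ℂ (Matrix ι ι ℂ) ⟨U, hU⟩
  have hφ : ∀ X, φ X = U * X * Uᴴ := fun X => rfl
  have hc : Continuous φ := by
    change Continuous fun X => φ X
    simp only [hφ]
    fun_prop
  have := StarAlgHomClass.map_cfc (S := ℂ) φ f A (hfin.continuousOn f) hc hA (by
    change IsSelfAdjoint (φ A)
    exact IsSelfAdjoint.map (show IsSelfAdjoint A from hA) φ)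
  rw [← hφ, ← hφ, this]

/-- The logarithmic mean `∫₀¹ a^{1-s} b^s ds`. -/
noncomputable def logMean (a b : ℝ) : ℝ := ∫ s in (0 : ℝ)..1, a ^ (1 - s) * b ^ s

theorem logMean_mul_log_sub_log {a b : ℝ} (ha : 0 < a) (hb : 0 < b) :
    logMean a b * (Real.log b - Real.log a) = b - a := by
  have hd : ∀ s ∈ Set.uIcc (0 : ℝ) 1, HasDerivAt (fun s => a ^ (1 - s) * b ^ s)
      (a ^ (1 - s) * b ^ s * (Real.log b - Real.log a)) s := by
    intro s _
    have h1 := ((hasDerivAt_id s).const_sub 1).const_rpow ha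
    have h2 := (hasDerivAt_id s).const_rpow hb
    exact (h1.mul h2).congr_deriv (by simp; ring)
  have hcont : Continuous fun s : ℝ => a ^ (1 - s) * b ^ s :=
    (Real.continuous_const_rpow ha.ne' |>.comp (by fun_prop)).mul (Real.continuous_const_rpow hb.ne')
  rw [logMean, ← intervalIntegral.integral_mul_const,
    intervalIntegral.integral_eq_sub_of_hasDerivAt hd
      ((hcont.mul continuous_const).intervalIntegrable _ _)]
  simp

/-- The grading operator `U ⊗ ⋯ ⊗ U`. -/
def gradOp (n : ℕ) : Op n := tensor fun _ => uMat

variable {n : ℕ}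

theorem gradOp_mul_self : gradOp n * gradOp n = 1 := by
  rw [gradOp, tensor_mul]; simp only [uMat_sq]; exact tensor_one

theorem uMat_conjTranspose : uMatᴴ = uMat := by
  ext a b; fin_cases a <;> fin_cases b <;> simp [uMat]

theorem tensor_conjTranspose (X : Fin n → Matrix (Fin 2) (Fin 2) ℂ) :
    (tensor X)ᴴ = tensor fun i => (X i)ᴴ := by
  ext x y
  simp [tensor, Matrix.conjTranspose_apply, star_prod]

theorem gradOp_conjTranspose : (gradOp n)ᴴ = gradOp n := by
  rw [gradOp, tensor_conjTranspose, uMat_conjTranspose]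

theorem grading_eq (A : Op n) : grading A = gradOp n * A * gradOp n := rfl

theorem gradOp_mem_unitaryGroup : gradOp n ∈ Matrix.unitaryGroup (Fin n → Fin 2) ℂ := by
  rw [Matrix.mem_unitaryGroup_iff, Matrix.star_eq_conjTranspose, gradOp_conjTranspose,
    gradOp_mul_self]

theorem cfc_grading {A : Op n} (hA : A.IsHermitian) (f : ℝ → ℝ) :
    cfc f (grading A) = grading (cfc f A) := by
  have := cfc_conj gradOp_mem_unitaryGroup hA f
  rwa [gradOp_conjTranspose] at this

/-- Up to the grading operator, `∇_i` is the inner derivation by `½ G Q_i`. -/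
theorem gradOp_mul_partialD (i : Fin n) (A : Op n) :
    gradOp n * partialD i A = (1 / 2 : ℂ) • (gradOp n * gen i * A - A * (gradOp n * gen i)) := by
  rw [partialD, mul_smul_comm, grading_eq, mul_sub]
  congr 2
  · rw [mul_assoc]
  · simp only [← mul_assoc, gradOp_mul_self, one_mul]

section Sharp

variable {ρ V : Op n} {b : (Fin n → Fin 2) → ℝ} (D : Diagonalizes ρ V b)
include D

/-- In an eigenbasis of `ρ`, the operation `(Γ(ρ), ρ) # ·` multiplies matrix entries by logarithmic
means of eigenvalues. -/
theorem Diagonalizes.sharp_eq (hρ : ρ.IsHermitian) (C : Op n) :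
    sharp (grading ρ) ρ C = gradOp n * V *
      (Matrix.of fun k l => (logMean (b k) (b l) : ℂ) * (Vᴴ * (gradOp n * C) * V) k l) * Vᴴ := by
  ext x y
  simp only [sharp, rpowOp, Matrix.of_apply, cfc_grading hρ]
  simp only [D.cfc_eq, grading_eq]
  set N := Vᴴ * (gradOp n * C) * V with hN
  set P := gradOp n * V
  have hI : ∀ s : ℝ, (gradOp n * (V * Matrix.diagonal (fun i => ((b i ^ (1 - s) : ℝ) : ℂ)) * Vᴴ) *
      gradOp n * C * (V * Matrix.diagonal (fun i => ((b i ^ s : ℝ) : ℂ)) * Vᴴ)) x y =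
      ∑ l, ∑ k, (P x k * N k l * Vᴴ l y) * ((b k ^ (1 - s) * b l ^ s : ℝ) : ℂ) := by
    intro s
    have : gradOp n * (V * Matrix.diagonal (fun i => ((b i ^ (1 - s) : ℝ) : ℂ)) * Vᴴ) *
      gradOp n * C * (V * Matrix.diagonal (fun i => ((b i ^ s : ℝ) : ℂ)) * Vᴴ) =
      P * (Matrix.diagonal (fun i => ((b i ^ (1 - s) : ℝ) : ℂ)) * N *
        Matrix.diagonal (fun i => ((b i ^ s : ℝ) : ℂ))) * Vᴴ := by
      simp only [P, hN, mul_assoc]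
    rw [this, Matrix.mul_apply]
    refine Finset.sum_congr rfl fun l _ => ?_
    rw [Matrix.mul_apply, Finset.sum_mul]
    refine Finset.sum_congr rfl fun k _ => ?_
    rw [Matrix.mul_diagonal, Matrix.diagonal_mul]
    push_cast; ring
  have hc : ∀ k l, IntervalIntegrable (fun s : ℝ => (P x k * N k l * Vᴴ l y) *
      ((b k ^ (1 - s) * b l ^ s : ℝ) : ℂ)) MeasureTheory.volume 0 1 := by
    intro k l
    have h1 : Continuous fun s : ℝ => b k ^ (1 - s) * b l ^ s :=
      (Real.continuous_const_rpow (D.pos k).ne' |>.comp (by fun_prop)).mul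
        (Real.continuous_const_rpow (D.pos l).ne')
    exact (continuous_const.mul (Complex.continuous_ofReal.comp h1)).intervalIntegrable _ _
  simp only [hI]
  rw [intervalIntegral.integral_finsetSum fun l _ => by
      simpa only [Finset.sum_fn] using IntervalIntegrable.sum Finset.univ fun k _ => hc k l,
    Matrix.mul_apply]
  refine Finset.sum_congr rfl fun l _ => ?_
  rw [intervalIntegral.integral_finsetSum fun k _ => hc k l, Matrix.mul_apply, Finset.sum_mul]
  refine Finset.sum_congr rfl fun k _ => ?_
  rw [intervalIntegral.integral_const_mul, intervalIntegral.integral_ofReal, Matrix.of_apply,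
    ← logMean]
  ring

theorem Diagonalizes.trace_sharp (hρ : ρ.IsHermitian) (W C : Op n) :
    (Wᴴ * sharp (grading ρ) ρ C).trace = ∑ k, ∑ l, star ((Vᴴ * (gradOp n * W) * V) k l) *
      ((logMean (b k) (b l) : ℂ) * (Vᴴ * (gradOp n * C) * V) k l) := by
  rw [D.sharp_eq hρ]
  set T : Op n := Matrix.of fun k l => (logMean (b k) (b l) : ℂ) * (Vᴴ * (gradOp n * C) * V) k l
  have h1 : Wᴴ * (gradOp n * V * T * Vᴴ) = (gradOp n * W)ᴴ * (V * T * Vᴴ) := by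
    rw [Matrix.conjTranspose_mul, gradOp_conjTranspose]; simp only [mul_assoc]
  have h2 : Vᴴ * (V * T * Vᴴ) * V = T := by
    simp only [mul_assoc, D.left, mul_one]
    rw [← mul_assoc, D.left, one_mul]
  rw [h1, D.trace_conjTranspose_mul, h2]
  simp only [T, Matrix.of_apply]

end Sharp

/-- `(Γ(ρ), ρ) # ·` is self-adjoint in `L²(τ)`. -/
theorem tau_sharp_comm {ρ : Op n} (hρ : ρ.PosDef) (W C : Op n) :
    tau (Wᴴ * sharp (grading ρ) ρ C) = star (tau (Cᴴ * sharp (grading ρ) ρ W)) := by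
  obtain ⟨V, b, D⟩ := exists_diagonalizes hρ
  have key : (Wᴴ * sharp (grading ρ) ρ C).trace =
      star (Cᴴ * sharp (grading ρ) ρ W).trace := by
    rw [D.trace_sharp hρ.1, D.trace_sharp hρ.1, star_sum]
    refine Finset.sum_congr rfl fun k _ => ?_
    rw [star_sum]
    refine Finset.sum_congr rfl fun l _ => ?_
    rw [star_mul', star_mul', star_star, Complex.star_def, Complex.conj_ofReal]
    ring
  unfold tau
  rw [key, star_mul', star_inv₀, star_pow]
  simp

theorem sharp_smul {ρ : Op n} (hρ : ρ.PosDef) (c : ℂ) (C : Op n) :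
    sharp (grading ρ) ρ (c • C) = c • sharp (grading ρ) ρ C := by
  obtain ⟨V, b, D⟩ := exists_diagonalizes hρ
  rw [D.sharp_eq hρ.1, D.sharp_eq hρ.1, ← smul_mul_assoc, ← mul_smul_comm]
  congr 2
  ext k l
  simp only [mul_smul_comm, smul_mul_assoc, Matrix.smul_apply, Matrix.of_apply, smul_eq_mul]
  ring

/-- The chain rule `(Γ(ρ), ρ) # ∇_i log ρ = ∇_i ρ`. -/
theorem sharp_partialD_log {ρ : Op n} (hρ : ρ.PosDef) (i : Fin n) :
    sharp (grading ρ) ρ (partialD i (cfc Real.log ρ)) = partialD i ρ := by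
  obtain ⟨V, b, D⟩ := exists_diagonalizes hρ
  have h : (Matrix.of fun k l => (logMean (b k) (b l) : ℂ) *
      (Vᴴ * (gradOp n * partialD i (cfc Real.log ρ)) * V) k l) =
      Vᴴ * (gradOp n * partialD i ρ) * V := by
    ext k l
    rw [Matrix.of_apply, gradOp_mul_partialD, gradOp_mul_partialD, mul_smul_comm, mul_smul_comm,
      smul_mul_assoc, smul_mul_assoc, Matrix.smul_apply, Matrix.smul_apply,
      D.frame_commutator_cfc, D.frame_commutator, ← logMean_mul_log_sub_log (D.pos k) (D.pos l)]
    simp only [smul_eq_mul]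
    push_cast
    ring
  rw [D.sharp_eq hρ.1, h]
  calc _ = gradOp n * (V * Vᴴ) * (gradOp n * partialD i ρ) * (V * Vᴴ) := by simp only [mul_assoc]
    _ = _ := by rw [D.right, mul_one, mul_one, ← mul_assoc, gradOp_mul_self, one_mul]

/-! ### Sign flips of the generators -/

/-- The diagonal operator with `U` in the tensor positions `j ∈ S` and `I` elsewhere. Conjugation by
it flips the sign of the generators `Q_j`, `j ∈ S`. -/
def signOp (S : Finset (Fin n)) : Op n := tensor fun j => if j ∈ S then uMat else 1

theorem uMat_eq_diagonal : uMat = Matrix.diagonal fun a : Fin 2 => (-1 : ℂ) ^ (a : ℕ) := by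
  ext a b; fin_cases a <;> fin_cases b <;> simp [uMat]

theorem signOp_eq_diagonal (S : Finset (Fin n)) :
    signOp S = Matrix.diagonal fun x => ∏ j ∈ S, (-1 : ℂ) ^ (x j : ℕ) := by
  have h : ∀ j : Fin n, (if j ∈ S then uMat else 1) =
      Matrix.diagonal fun a : Fin 2 => if j ∈ S then (-1 : ℂ) ^ (a : ℕ) else 1 := by
    intro j
    split_ifs
    · exact uMat_eq_diagonal
    · exact Matrix.diagonal_one.symm
  ext x y
  simp only [signOp, h, tensor, Matrix.of_apply]
  by_cases hxy : x = y
  · subst hxy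
    simp [Finset.prod_ite_mem]
  · obtain ⟨i, hi⟩ := Function.ne_iff.mp hxy
    rw [Matrix.diagonal_apply_ne _ hxy]
    exact Finset.prod_eq_zero (Finset.mem_univ i) (Matrix.diagonal_apply_ne _ hi)

theorem signOp_mul_self (S : Finset (Fin n)) : signOp S * signOp S = 1 := by
  rw [signOp, tensor_mul, ← tensor_one]
  congr 1
  funext i
  split_ifs <;> simp [uMat_sq]

theorem signOp_conjTranspose (S : Finset (Fin n)) : (signOp S)ᴴ = signOp S := by
  rw [signOp, tensor_conjTranspose]
  congr 1
  funext i
  split_ifs <;> simp [uMat_conjTranspose]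

theorem gradOp_eq_signOp : gradOp n = signOp Finset.univ := by simp [gradOp, signOp]

/-- The automorphism `Q_j ↦ -Q_j` for `j ∈ S`, `Q_j ↦ Q_j` for `j ∉ S`. -/
def flip (S : Finset (Fin n)) (A : Op n) : Op n := signOp S * A * signOp S

theorem flip_mul (S : Finset (Fin n)) (A B : Op n) : flip S (A * B) = flip S A * flip S B := by
  simp only [flip]
  calc _ = signOp S * A * 1 * B * signOp S := by simp [mul_assoc]
    _ = _ := by rw [← signOp_mul_self S]; simp only [mul_assoc]

theorem flip_gen (S : Finset (Fin n)) (j : Fin n) :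
    flip S (gen j) = if j ∈ S then -gen j else gen j := by
  have hk : ∀ k, k ≠ j → ((if k ∈ S then uMat else 1) *
      if k < j then uMat else if k = j then qMat else 1) * (if k ∈ S then uMat else 1) =
      if k < j then uMat else if k = j then qMat else 1 := by
    intro k hk
    split_ifs <;> simp [uMat_sq]
  rw [flip, gen, signOp, tensor_mul, tensor_mul]
  split_ifs with h
  · refine tensor_neg j _ _ ?_ hk
    simp only [lt_irrefl, if_false, if_true, h]
    rw [mul_assoc, qMat_mul_uMat, mul_neg, ← mul_assoc, uMat_sq, one_mul]
  · congr 1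
    funext k
    rcases eq_or_ne k j with rfl | hne
    · simp [h]
    · exact hk k hne

theorem flip_apply (S : Finset (Fin n)) (A : Op n) (x y : Fin n → Fin 2) :
    flip S A x y = (∏ j ∈ S, (-1 : ℂ) ^ (x j : ℕ) * (-1 : ℂ) ^ (y j : ℕ)) * A x y := by
  rw [flip, signOp_eq_diagonal, Matrix.mul_diagonal, Matrix.diagonal_mul, Finset.prod_mul_distrib]
  ring

theorem neg_one_pow_mul_neg_one_pow (a b : Fin 2) :
    (-1 : ℂ) ^ (a : ℕ) * (-1 : ℂ) ^ (b : ℕ) = if a ≠ b then -1 else 1 := by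
  fin_cases a <;> fin_cases b <;> simp

theorem gen_mem_cliff (j : Fin n) : gen j ∈ cliff n := Algebra.subset_adjoin ⟨j, rfl⟩

theorem flip_mem_cliff (S : Finset (Fin n)) {A : Op n} (hA : A ∈ cliff n) :
    flip S A ∈ cliff n := by
  induction hA using Algebra.adjoin_induction with
  | mem A hA =>
    obtain ⟨j, rfl⟩ := hA
    rw [flip_gen]
    split_ifs
    · exact neg_mem (gen_mem_cliff j)
    · exact gen_mem_cliff j
  | algebraMap c =>
    have : flip S (algebraMap ℂ (Op n) c) = algebraMap ℂ (Op n) c := by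
      rw [flip, Algebra.algebraMap_eq_smul_one, mul_smul_comm, smul_mul_assoc, mul_one,
        signOp_mul_self]
    rw [this]
    exact Subalgebra.algebraMap_mem _ c
  | add A B _ _ hA hB =>
    rw [flip, mul_add, add_mul]
    exact add_mem hA hB
  | mul A B _ _ hA hB =>
    rw [flip_mul]
    exact mul_mem hA hB

/-- Moving a generator across an element of the Clifford algebra: `Γ(A) Q_i = Q_i Θ_i(A)`, where
`Θ_i` flips the sign of `Q_i` only. -/
theorem grading_mul_gen {A : Op n} (hA : A ∈ cliff n) (i : Fin n) :
    grading A * gen i = gen i * flip {i} A := by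
  induction hA using Algebra.adjoin_induction with
  | mem A hA =>
    obtain ⟨j, rfl⟩ := hA
    rw [grading_gen, flip_gen]
    split_ifs with h
    · rw [Finset.mem_singleton] at h
      subst h
      simp
    · rw [Finset.mem_singleton] at h
      rw [neg_mul, gen_anticomm h, neg_neg]
  | algebraMap c =>
    simp only [grading_eq, flip, Algebra.algebraMap_eq_smul_one, mul_smul_comm, smul_mul_assoc,
      mul_one, signOp_mul_self, gradOp_mul_self, one_mul]
  | add A B _ _ hA hB =>
    simp only [grading_eq, flip, mul_add, add_mul] at hA hB ⊢
    rw [hA, hB]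
  | mul A B _ _ hA hB =>
    rw [grading_mul, flip_mul, mul_assoc, hB, ← mul_assoc, hA, mul_assoc]

/-! ### Partial derivatives and the number operator -/

/-- The part of `A` which is odd in the generator `Q_i`: the matrix entries whose indices differ in
position `i`. -/
def oddPart (i : Fin n) (A : Op n) : Op n := Matrix.of fun x y => if x i ≠ y i then A x y else 0

theorem oddPart_eq (i : Fin n) (A : Op n) : oddPart i A = (1 / 2 : ℂ) • (A - flip {i} A) := by
  ext x y
  rw [Matrix.smul_apply, Matrix.sub_apply, flip_apply, Finset.prod_singleton,
    neg_one_pow_mul_neg_one_pow, oddPart, Matrix.of_apply]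
  split_ifs
  · simp; ring
  · simp

theorem partialD_eq {A : Op n} (hA : A ∈ cliff n) (i : Fin n) :
    partialD i A = gen i * oddPart i A := by
  rw [partialD, grading_mul_gen hA, oddPart_eq, mul_smul_comm, mul_sub]

theorem oddPart_mem_cliff {A : Op n} (hA : A ∈ cliff n) (i : Fin n) : oddPart i A ∈ cliff n := by
  rw [oddPart_eq]
  exact Subalgebra.smul_mem _ (sub_mem hA (flip_mem_cliff _ hA)) _

theorem flip_oddPart (i : Fin n) (A : Op n) : flip {i} (oddPart i A) = -oddPart i A := by
  ext x y
  rw [flip_apply, Finset.prod_singleton, neg_one_pow_mul_neg_one_pow, oddPart, Matrix.neg_apply,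
    Matrix.of_apply]
  split_ifs <;> simp

theorem partialDAdj_partialD {A : Op n} (hA : A ∈ cliff n) (i : Fin n) :
    partialDAdj i (partialD i A) = oddPart i A := by
  rw [partialD_eq hA, partialDAdj, grading_mul, grading_gen, mul_assoc,
    grading_mul_gen (oddPart_mem_cliff hA i), flip_oddPart, neg_mul, ← mul_assoc, mul_neg, mul_neg,
    neg_neg, ← mul_assoc, gen_sq, one_mul, ← two_smul ℂ, smul_smul]
  norm_num

/-- The number operator `-div ∇`, which multiplies `Q^α` by `|α|`. The nonzero entries of `Q^α` are
those whose indices differ exactly on `α`, so the factor is the Hamming distance of the indices. -/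
noncomputable def numberOp (A : Op n) : Op n := Matrix.of fun x y => (hammingDist x y : ℂ) * A x y

theorem dive_grad {A : Op n} (hA : A ∈ cliff n) : dive (grad A) = -numberOp A := by
  simp only [dive, grad, partialDAdj_partialD hA]
  congr 1
  ext x y
  rw [Matrix.sum_apply, numberOp, Matrix.of_apply, hammingDist, Finset.card_filter]
  push_cast
  rw [Finset.sum_mul]
  refine Finset.sum_congr rfl fun i _ => ?_
  rw [oddPart, Matrix.of_apply]
  split_ifs <;> simp_all

/-! ### The fermionic Mehler semigroup -/

/-- The fermionic Mehler semigroup `e^{-tN}`, in the parameter `r = e^{-t}`. -/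
noncomputable def mehler (r : ℝ) (A : Op n) : Op n :=
  Matrix.of fun x y => (r : ℂ) ^ hammingDist x y * A x y

theorem mehler_apply (r : ℝ) (A : Op n) (x y : Fin n → Fin 2) :
    mehler r A x y = (r : ℂ) ^ hammingDist x y * A x y := rfl

/-- The weights of the sign flips in `mehler r`: every sign is flipped independently with
probability `(1 - r) / 2`. -/
noncomputable def flipWeight (r : ℝ) (S : Finset (Fin n)) : ℝ :=
  (∏ _j ∈ S, (1 - r) / 2) * ∏ _j ∈ Finset.univ \ S, (1 + r) / 2

theorem flipWeight_nonneg {r : ℝ} (hr : r ∈ Set.Icc (0 : ℝ) 1) (S : Finset (Fin n)) :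
    0 ≤ flipWeight r S :=
  mul_nonneg (Finset.prod_nonneg fun _ _ => by linarith [hr.2])
    (Finset.prod_nonneg fun _ _ => by linarith [hr.1])

theorem sum_flipWeight (r : ℝ) :
    ∑ S ∈ (Finset.univ : Finset (Fin n)).powerset, flipWeight r S = 1 := by
  simp only [flipWeight, ← Finset.prod_add]
  exact Finset.prod_eq_one fun _ _ => by ring

theorem mehler_eq_mixture (r : ℝ) (A : Op n) :
    mehler r A = mixture (Finset.univ : Finset (Fin n)).powerset (flipWeight r) signOp A := by
  ext x y
  have h : ∀ S : Finset (Fin n), ((flipWeight r S : ℂ) • (signOp S * A * (signOp S)ᴴ)) x y =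
      ((∏ j ∈ S, (((1 - r) / 2 : ℂ) * ((-1 : ℂ) ^ (x j : ℕ) * (-1 : ℂ) ^ (y j : ℕ)))) *
        ∏ _j ∈ Finset.univ \ S, ((1 + r) / 2 : ℂ)) * A x y := by
    intro S
    rw [signOp_conjTranspose, Matrix.smul_apply, ← flip, flip_apply, smul_eq_mul, flipWeight,
      Finset.prod_mul_distrib (f := fun _ => ((1 - r) / 2 : ℂ))]
    push_cast
    ring
  rw [mixture, Matrix.sum_apply, Finset.sum_congr rfl fun S _ => h S, ← Finset.sum_mul,
    ← Finset.prod_add, mehler, Matrix.of_apply, hammingDist, ← Finset.prod_const,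
    Finset.prod_filter]
  congr 1
  refine Finset.prod_congr rfl fun j _ => ?_
  rw [neg_one_pow_mul_neg_one_pow]
  split_ifs <;> ring

theorem mehler_mem_cliff (r : ℝ) {A : Op n} (hA : A ∈ cliff n) : mehler r A ∈ cliff n := by
  rw [mehler_eq_mixture]
  refine Subalgebra.sum_mem _ fun S _ => Subalgebra.smul_mem _ ?_ _
  rw [signOp_conjTranspose]
  exact flip_mem_cliff S hA

theorem mehler_posDef {r : ℝ} (hr : r ∈ Set.Icc (0 : ℝ) 1) {A : Op n} (hA : A.PosDef) :
    (mehler r A).PosDef := by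
  have hS : ∀ S : Finset (Fin n), (signOp S * A * (signOp S)ᴴ).PosDef := fun S =>
    hA.mul_mul_conjTranspose_same (Matrix.vecMul_injective_of_isUnit
      (IsUnit.of_mul_eq_one _ (signOp_mul_self S)))
  obtain ⟨S, hmem, hpos⟩ : ∃ S ∈ (Finset.univ : Finset (Fin n)).powerset, 0 < flipWeight r S := by
    by_contra! h
    have := Finset.sum_nonpos h
    rw [sum_flipWeight] at this
    linarith
  rw [mehler_eq_mixture, mixture, ← Finset.add_sum_erase _ _ hmem]
  refine ((hS S).smul (by exact_mod_cast hpos)).add_posSemidef ?_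
  exact Matrix.posSemidef_sum _ fun T _ =>
    (hS T).posSemidef.smul (by exact_mod_cast flipWeight_nonneg hr T)

theorem tau_mehler (r : ℝ) (A : Op n) : tau (mehler r A) = tau A := by
  simp [tau, mehler, Matrix.trace]

theorem mehler_mem_densPos {r : ℝ} (hr : r ∈ Set.Icc (0 : ℝ) 1) {ρ : Op n} (hρ : ρ ∈ densPos n) :
    mehler r ρ ∈ densPos n :=
  ⟨mehler_mem_cliff r hρ.1, mehler_posDef hr hρ.2.1, by rw [tau_mehler, hρ.2.2]⟩

theorem mehler_one (A : Op n) : mehler 1 A = A := by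
  ext x y; simp [mehler]

theorem mehler_mehler (r s : ℝ) (A : Op n) : mehler r (mehler s A) = mehler (r * s) A := by
  ext x y; simp [mehler, mul_pow, mul_assoc]

theorem gen_apply_ne_zero {i : Fin n} {x y : Fin n → Fin 2} (h : gen i x y ≠ 0) (j : Fin n) :
    x j = y j ↔ j ≠ i := by
  simp only [gen, tensor, Matrix.of_apply, Finset.prod_ne_zero_iff] at h
  have := h j (Finset.mem_univ j)
  generalize x j = a at *
  generalize y j = b at *
  split_ifs at this with h1 h2
  · fin_cases a <;> fin_cases b <;> simp_all [uMat, h1.ne]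
  · fin_cases a <;> fin_cases b <;> simp_all [qMat]
  · fin_cases a <;> fin_cases b <;> simp_all

theorem gen_apply_ne_zero_of (i : Fin n) {x y : Fin n → Fin 2}
    (h : ∀ j, x j = y j ↔ j ≠ i) : gen i x y ≠ 0 := by
  simp only [gen, tensor, Matrix.of_apply, Finset.prod_ne_zero_iff]
  intro j _
  have := h j
  generalize x j = a at *
  generalize y j = b at *
  split_ifs with h1 h2
  · fin_cases a <;> fin_cases b <;> simp_all [uMat, h1.ne]
  · fin_cases a <;> fin_cases b <;> simp_all [qMat]
  · fin_cases a <;> fin_cases b <;> simp_all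

/-- A generator lowers the Hamming distance of the indices of an entry that is odd in it. -/
theorem hammingDist_succ {i : Fin n} {x y z : Fin n → Fin 2} (h : ∀ j, x j = z j ↔ j ≠ i)
    (hz : z i ≠ y i) : hammingDist z y = hammingDist x y + 1 := by
  have hxi : x i = y i := by
    have : x i ≠ z i := fun e => (h i).1 e rfl
    omega
  have : (Finset.univ.filter fun j => z j ≠ y j) =
      insert i (Finset.univ.filter fun j => x j ≠ y j) := by
    ext j
    simp only [Finset.mem_filter, Finset.mem_univ, true_and, Finset.mem_insert]
    rcases eq_or_ne j i with rfl | hj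
    · simp [hz]
    · rw [(h j).2 hj]; simp [hj]
  rw [hammingDist, hammingDist, this, Finset.card_insert_of_notMem (by simp [hxi])]

/-- The gradient commutes with the Mehler semigroup up to the factor `r = e^{-t}`, because `∇_i`
lowers the degree by one. -/
theorem partialD_mehler (r : ℝ) {A : Op n} (hA : A ∈ cliff n) (i : Fin n) :
    partialD i (mehler r A) = (r : ℂ) • mehler r (partialD i A) := by
  rw [partialD_eq (mehler_mem_cliff r hA), partialD_eq hA]
  ext x y
  rw [Matrix.smul_apply, mehler_apply, Matrix.mul_apply, Matrix.mul_apply,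
    Finset.mul_sum, Finset.smul_sum]
  refine Finset.sum_congr rfl fun z _ => ?_
  simp only [oddPart, mehler, Matrix.of_apply, smul_eq_mul]
  by_cases hg : gen i x z = 0
  · simp [hg]
  by_cases hz : z i ≠ y i
  · rw [if_pos hz, if_pos hz, hammingDist_succ (gen_apply_ne_zero hg) hz, pow_succ]
    ring
  · simp [hz]

theorem gradOp_mul_mehler (r : ℝ) (A : Op n) :
    gradOp n * mehler r A = mehler r (gradOp n * A) := by
  ext x y
  rw [gradOp_eq_signOp, signOp_eq_diagonal]
  simp only [mehler, Matrix.diagonal_mul, Matrix.of_apply]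
  ring

theorem mehler_smul (r : ℝ) (c : ℂ) (A : Op n) : mehler r (c • A) = c • mehler r A := by
  ext x y
  simp only [mehler, Matrix.of_apply, Matrix.smul_apply, smul_eq_mul]
  ring

theorem commutator_mehler (r : ℝ) {A : Op n} (hA : A ∈ cliff n) (i : Fin n) :
    gradOp n * gen i * mehler r A - mehler r A * (gradOp n * gen i) =
      (r : ℂ) • mehler r (gradOp n * gen i * A - A * (gradOp n * gen i)) := by
  have h := congrArg (gradOp n * ·) (partialD_mehler r hA i)
  simp only [mul_smul_comm, gradOp_mul_partialD, gradOp_mul_mehler, mehler_smul] at h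
  rw [smul_comm] at h
  exact smul_right_injective _ (by norm_num : (1 / 2 : ℂ) ≠ 0) h

theorem commForm_mehler_le {r : ℝ} (hr : r ∈ Set.Icc (0 : ℝ) 1) {ρ : Op n} (hρ : ρ ∈ densPos n)
    (i : Fin n) :
    commForm (mehler r ρ) (gradOp n * gen i) ≤ r ^ 2 * commForm ρ (gradOp n * gen i) := by
  have h := commutator_mehler r hρ.1 i
  have hp := mehler_posDef hr hρ.2.1
  rw [mehler_eq_mixture] at hp ⊢
  rw [mehler_eq_mixture, mehler_eq_mixture] at h
  exact commForm_mixture_le (fun S _ => flipWeight_nonneg hr S) (sum_flipWeight r)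
    (fun S _ => by rw [signOp_conjTranspose, signOp_mul_self]) hρ.2.1 hp h

/-- A density of the Clifford algebra is driven to the identity. At `r = 0` the convention `0 ^ 0 = 1`
leaves exactly the diagonal of `ρ`; being an element of the Clifford algebra that is even in every
generator, it commutes with all generators, and is therefore constant. -/
theorem mehler_zero {ρ : Op n} (hρ : ρ ∈ cliff n) (h1 : tau ρ = 1) : mehler 0 ρ = 1 := by
  have hz : ∀ x y, x ≠ y → mehler 0 ρ x y = 0 := fun x y hxy => by
    simp [mehler, hammingDist_ne_zero.2 hxy]
  have hd : ∀ x, mehler 0 ρ x x = ρ x x := fun x => by simp [mehler]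
  have hcomm : ∀ i, mehler 0 ρ * gen i = gen i * mehler 0 ρ := by
    intro i
    have hD : mehler 0 ρ = Matrix.diagonal fun x => ρ x x := by
      ext x y
      rcases eq_or_ne x y with rfl | h
      · simp [hd]
      · rw [hz x y h, Matrix.diagonal_apply_ne _ h]
    have hflip : ∀ S, flip S (mehler 0 ρ) = mehler 0 ρ := by
      intro S
      rw [hD, flip, signOp_eq_diagonal, Matrix.diagonal_mul_diagonal, Matrix.diagonal_mul_diagonal]
      congr 1
      funext x
      rw [mul_right_comm, ← Finset.prod_mul_distrib, Finset.prod_eq_one, one_mul]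
      intro j _
      rw [neg_one_pow_mul_neg_one_pow]; simp
    have := grading_mul_gen (mehler_mem_cliff 0 hρ) i
    rwa [hflip, grading_eq, gradOp_eq_signOp, ← flip, hflip] at this
  have hstep : ∀ x i a, ρ (Function.update x i a) (Function.update x i a) = ρ x x := by
    intro x i a
    rcases eq_or_ne a (x i) with rfl | ha
    · rw [Function.update_eq_self]
    have hg : gen i x (Function.update x i a) ≠ 0 := by
      refine gen_apply_ne_zero_of i fun j => ?_
      rcases eq_or_ne j i with rfl | hj
      · simp [ha.symm]
      · simp [hj]
    have := congrFun (congrFun (hcomm i) x) (Function.update x i a)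
    rw [Matrix.mul_apply, Matrix.mul_apply,
      Finset.sum_eq_single x (fun z _ hzx => by rw [hz x z hzx.symm, zero_mul]) (by simp),
      Finset.sum_eq_single (Function.update x i a) (fun z _ hzx => by rw [hz z _ hzx, mul_zero])
        (by simp), hd, hd, mul_comm] at this
    exact (mul_left_cancel₀ hg this).symm
  have hconst : ∀ x y, ρ x x = ρ y y := by
    intro x y
    have : ∀ S : Finset (Fin n), ρ (S.piecewise x y) (S.piecewise x y) = ρ y y := by
      intro S
      induction S using Finset.induction_on with
      | empty => simp
      | insert j S _ ih => rw [Finset.piecewise_insert, hstep, ih]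
    simpa using this Finset.univ
  ext x y
  rcases eq_or_ne x y with rfl | hxy
  · rw [hd, Matrix.one_apply_eq]
    have : ρ.trace = 2 ^ n * ρ x x := by
      change ∑ y, ρ y y = _
      rw [Finset.sum_congr rfl fun y _ => hconst y x]
      simp
    rw [tau, this, ← mul_assoc, inv_mul_cancel₀ (by positivity), one_mul] at h1
    exact h1
  · rw [hz x y hxy, Matrix.one_apply_ne hxy]

theorem cfc_mem_cliff {ρ : Op n} (hρ : ρ.PosDef) (h : ρ ∈ cliff n) (f : ℝ → ℝ) :
    cfc f ρ ∈ cliff n := by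
  -- On the finite spectrum of `ρ` the function `f` agrees with a polynomial.
  have hfin : (spectrum ℝ ρ).Finite := by
    rw [hρ.1.spectrum_real_eq_range_eigenvalues]; exact Set.finite_range _
  let p := Lagrange.interpolate hfin.toFinset id f
  have hp : cfc f ρ = Polynomial.aeval ρ p := by
    rw [← cfc_polynomial p ρ hρ.1]
    refine cfc_congr fun x hx => ?_
    exact (Lagrange.eval_interpolate_at_node f (Set.injOn_id _) (hfin.mem_toFinset.2 hx)).symm
  rw [hp]
  exact Algebra.adjoin_le (S := (cliff n).restrictScalars ℝ) (Set.singleton_subset_iff.2 h)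
    (Polynomial.aeval_mem_adjoin_singleton ℝ ρ)

/-! ### Fisher information -/

/-- The Fisher information `τ(log ρ · N ρ)`. -/
noncomputable def fisher (ρ : Op n) : ℝ := (tau (cfc Real.log ρ * numberOp ρ)).re

theorem cfc_conjTranspose (ρ : Op n) (f : ℝ → ℝ) : (cfc f ρ)ᴴ = cfc f ρ :=
  (cfc_predicate f ρ : IsSelfAdjoint _)

theorem sum_tau_partialD (A : Op n) {B : Op n} (hB : B ∈ cliff n) :
    ∑ i, tau ((partialD i A)ᴴ * partialD i B) = tau (Aᴴ * numberOp B) := by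
  have h := dive_grad hB
  rw [dive, neg_inj] at h
  rw [← h, Finset.mul_sum, Finset.sum_congr rfl fun i _ => tau_partialD i A (partialD i B)]
  simp [tau, Matrix.trace_sum, Finset.mul_sum, grad]

theorem fisher_eq {ρ : Op n} (hρ : ρ ∈ cliff n) :
    fisher ρ = ∑ i, (2 ^ n : ℝ)⁻¹ * (1 / 4) * commForm ρ (gradOp n * gen i) := by
  have h := sum_tau_partialD (cfc Real.log ρ) hρ
  rw [cfc_conjTranspose] at h
  rw [fisher, ← h, Complex.re_sum]
  refine Finset.sum_congr rfl fun i _ => ?_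
  have h1 : (partialD i (cfc Real.log ρ))ᴴ * partialD i ρ =
      (gradOp n * partialD i (cfc Real.log ρ))ᴴ * (gradOp n * partialD i ρ) := by
    rw [Matrix.conjTranspose_mul, gradOp_conjTranspose, mul_assoc, ← mul_assoc (gradOp n),
      gradOp_mul_self, one_mul]
  rw [h1, gradOp_mul_partialD, gradOp_mul_partialD, Matrix.conjTranspose_smul, smul_mul_smul_comm,
    tau, Matrix.trace_smul, commForm]
  have h2 : ((2 : ℂ) ^ n)⁻¹ = (((2 ^ n : ℝ)⁻¹ : ℝ) : ℂ) := by push_cast; rfl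
  have h3 : star (1 / 2 : ℂ) * (1 / 2) = ((1 / 4 : ℝ) : ℂ) := by simp; norm_num
  rw [h2, h3, smul_eq_mul, Complex.re_ofReal_mul, Complex.re_ofReal_mul, ← mul_assoc]

theorem fisher_nonneg {ρ : Op n} (hρ : ρ ∈ densPos n) : 0 ≤ fisher ρ := by
  rw [fisher_eq hρ.1]
  exact Finset.sum_nonneg fun i _ => mul_nonneg (by positivity) (commForm_nonneg hρ.2.1 _)

/-- Exponential decay `I(e^{-tN} ρ) ≤ e^{-2t} I(ρ)` of the Fisher information. -/
theorem fisher_mehler_le {r : ℝ} (hr : r ∈ Set.Icc (0 : ℝ) 1) {ρ : Op n} (hρ : ρ ∈ densPos n) :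
    fisher (mehler r ρ) ≤ r ^ 2 * fisher ρ := by
  rw [fisher_eq hρ.1, fisher_eq (mehler_mem_cliff r hρ.1), Finset.mul_sum]
  refine Finset.sum_le_sum fun i _ => ?_
  rw [mul_left_comm]
  exact mul_le_mul_of_nonneg_left (commForm_mehler_le hr hρ i) (by positivity)

/-! ### The metric along the Mehler semigroup -/

theorem IsTangentField.sum_tau {ρ X : Op n} {V : Fin n → Op n} (hV : IsTangentField ρ X V)
    (U : Op n) : ∑ i, tau ((grad U i)ᴴ * sharpField ρ V i) = tau (Uᴴ * X) := by
  have hX : X = ∑ i, partialDAdj i (sharpField ρ V i) := by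
    have := hV.2
    rwa [dive, ← sub_eq_add_neg, sub_eq_zero] at this
  rw [hX, Finset.mul_sum]
  simp only [grad, tau_partialD]
  simp [tau, Matrix.trace_sum, Finset.mul_sum]

/-- All gradients that solve the continuity equation for the same velocity have the same norm,
because `(Γ(ρ), ρ) # ·` is self-adjoint. -/
theorem IsTangentField.normSqAt_eq {ρ X : Op n} (hρ : ρ.PosDef) {V V' : Fin n → Op n}
    (hV : IsTangentField ρ X V) (hV' : IsTangentField ρ X V') :
    normSqAt ρ V = normSqAt ρ V' := by
  obtain ⟨⟨U, _, rfl⟩, _⟩ := id hV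
  obtain ⟨⟨U', _, rfl⟩, _⟩ := id hV'
  rw [normSqAt, normSqAt, hV.sum_tau, hV'.sum_tau, ← hV'.sum_tau U, ← hV.sum_tau U']
  have : ∑ i, tau ((grad U i)ᴴ * sharpField ρ (grad U') i) =
      star (∑ i, tau ((grad U' i)ᴴ * sharpField ρ (grad U) i)) := by
    rw [star_sum]
    exact Finset.sum_congr rfl fun i _ => tau_sharp_comm hρ _ _
  rw [this, Complex.star_def, Complex.conj_re]

theorem metric_eq {ρ X : Op n} (hρ : ρ.PosDef) {V : Fin n → Op n} (hV : IsTangentField ρ X V) :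
    metric ρ X = ENNReal.ofReal (normSqAt ρ V) := by
  have h : ∃ V, IsTangentField ρ X V := ⟨V, hV⟩
  rw [metric, dif_pos h, h.choose_spec.normSqAt_eq hρ hV]

theorem partialD_smul (i : Fin n) (c : ℂ) (A : Op n) : partialD i (c • A) = c • partialD i A := by
  simp only [partialD, grading_eq, mul_smul_comm, smul_mul_assoc, ← smul_sub]
  rw [smul_comm]

theorem partialDAdj_smul (i : Fin n) (c : ℂ) (A : Op n) :
    partialDAdj i (c • A) = c • partialDAdj i A := by
  simp only [partialDAdj, grading_eq, mul_smul_comm, smul_mul_assoc, ← smul_add]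
  rw [smul_comm]

/-- The Mehler semigroup is the gradient flow of the entropy: its velocity is the divergence of
`(Γ(ρ), ρ) # ∇ log ρ`, so its squared speed is the Fisher information. -/
theorem metric_smul_numberOp {ρ : Op n} (hρ : ρ ∈ densPos n) (a : ℝ) :
    metric ρ ((a : ℂ) • numberOp ρ) = ENNReal.ofReal (a ^ 2 * fisher ρ) := by
  have hs : sharpField ρ (grad ((a : ℂ) • cfc Real.log ρ)) = fun i => (a : ℂ) • partialD i ρ := by
    funext i
    rw [sharpField, grad, partialD_smul, sharp_smul hρ.2.1, sharp_partialD_log hρ.2.1]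
  have hV : IsTangentField ρ ((a : ℂ) • numberOp ρ) (grad ((a : ℂ) • cfc Real.log ρ)) := by
    refine ⟨⟨_, Subalgebra.smul_mem _ (cfc_mem_cliff hρ.2.1 hρ.1 _) _, rfl⟩, ?_⟩
    have h := dive_grad hρ.1
    simp only [dive, grad] at h
    rw [hs]
    simp only [dive, partialDAdj_smul]
    rw [← Finset.smul_sum, ← smul_neg, h, smul_neg, add_neg_cancel]
  rw [metric_eq hρ.2.1 hV, normSqAt, hV.sum_tau, Matrix.conjTranspose_smul, cfc_conjTranspose,
    smul_mul_smul_comm, tau, Matrix.trace_smul, smul_eq_mul, mul_left_comm, ← tau, Complex.star_def,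
    Complex.conj_ofReal, ← Complex.ofReal_mul, Complex.re_ofReal_mul, ← fisher, ← sq]

theorem velocity_mehler (ρ : Op n) {t : ℝ} (ht : t < 1) :
    velocity (fun t => mehler (1 - t) ρ) t =
      ((-(1 - t)⁻¹ : ℝ) : ℂ) • numberOp (mehler (1 - t) ρ) := by
  ext x y
  rw [velocity, Matrix.of_apply, Matrix.smul_apply, numberOp, Matrix.of_apply]
  simp only [mehler_apply]
  have h1 : HasDerivAt (fun s : ℝ => ((1 - s : ℝ) : ℂ)) (((-1 : ℝ) : ℝ) : ℂ) t :=
    ((hasDerivAt_id t).const_sub 1).ofReal_comp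
  have h2 : HasDerivAt (fun s : ℝ => ((1 - s : ℝ) : ℂ) ^ hammingDist x y * ρ x y) _ t :=
    (h1.pow (hammingDist x y)).mul_const (ρ x y)
  rw [h2.deriv]
  have hne : ((1 - t : ℝ) : ℂ) ≠ 0 := by exact_mod_cast (sub_pos.2 ht).ne'
  rcases Nat.eq_zero_or_pos (hammingDist x y) with h0 | h0
  · simp [h0]
  · obtain ⟨d, hd⟩ := Nat.exists_eq_succ_of_ne_zero h0.ne'
    rw [hd, Nat.succ_eq_add_one, Nat.add_sub_cancel, pow_succ, smul_eq_mul]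
    push_cast at hne ⊢
    field_simp

/-- The curve `t ↦ e^{-sN} ρ`, `e^{-s} = 1 - t`, joins `ρ` to the identity in finite time. -/
theorem isCoupling_mehler {ρ : Op n} (hρ : ρ ∈ densPos n) :
    IsCoupling ρ 1 (fun t => mehler (1 - t) ρ) where
  mem t ht := mehler_mem_densPos ⟨by linarith [ht.2], by linarith [ht.1]⟩ hρ
  cont := by
    refine Continuous.continuousOn (continuous_matrix fun x y => ?_)
    simp only [mehler_apply]
    fun_prop
  smooth x y := by
    simp only [mehler_apply]
    refine ContDiff.contDiffOn (ContDiff.mul (ContDiff.pow ?_ _) contDiff_const)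
    exact Complex.ofRealCLM.contDiff.comp (contDiff_const.sub contDiff_id)
  start := by simp [mehler_one]
  finish := by simp [mehler_zero hρ.1 hρ.2.2]

/-! ### Entropy along the Mehler semigroup -/

theorem continuous_mehler (ρ : Op n) : Continuous fun r => mehler r ρ := by
  refine continuous_matrix fun x y => ?_
  simp only [mehler_apply]
  fun_prop

open scoped Matrix.Norms.L2Operator in
theorem continuousOn_log_mehler {ρ : Op n} (hρ : ρ ∈ densPos n) :
    ContinuousOn (fun r => cfc Real.log (mehler r ρ)) (Set.Icc 0 1) := by
  refine ContinuousOn.cfc_of_mem_nhdsSet (s := Set.Ioi 0) Real.log ?_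
    (continuous_mehler ρ).continuousOn (fun r hr => (mehler_posDef hr hρ.2.1).1)
    (Real.continuousOn_log.mono fun x hx => (Set.mem_Ioi.1 hx).ne')
  rw [IsOpen.mem_nhdsSet isOpen_Ioi]
  refine Set.iUnion₂_subset fun r hr x hx => ?_
  have hp := mehler_posDef hr hρ.2.1
  rw [hp.1.spectrum_real_eq_range_eigenvalues] at hx
  obtain ⟨i, rfl⟩ := hx
  exact hp.eigenvalues_pos i

/-- The difference quotient of `r ↦ mehler r ρ`, as a polynomial in both endpoints. -/
noncomputable def mehlerSlope (r s : ℝ) (ρ : Op n) : Op n := Matrix.of fun x y =>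
  (∑ i ∈ Finset.range (hammingDist x y), (r : ℂ) ^ i * (s : ℂ) ^ (hammingDist x y - 1 - i)) * ρ x y

theorem mehler_sub_mehler (r s : ℝ) (ρ : Op n) :
    mehler r ρ - mehler s ρ = ((r - s : ℝ) : ℂ) • mehlerSlope r s ρ := by
  ext x y
  rw [Matrix.sub_apply, mehler_apply, mehler_apply, ← sub_mul, ← geom_sum₂_mul, Matrix.smul_apply,
    mehlerSlope, Matrix.of_apply, smul_eq_mul]
  push_cast
  ring

theorem smul_mehlerSlope_self (r : ℝ) (ρ : Op n) :
    (r : ℂ) • mehlerSlope r r ρ = numberOp (mehler r ρ) := by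
  ext x y
  rw [Matrix.smul_apply, mehlerSlope, numberOp, Matrix.of_apply, Matrix.of_apply, mehler_apply,
    smul_eq_mul, geom_sum₂_self]
  rcases Nat.eq_zero_or_pos (hammingDist x y) with h0 | h0
  · simp [h0]
  · obtain ⟨d, hd⟩ := Nat.exists_eq_succ_of_ne_zero h0.ne'
    rw [hd, Nat.succ_eq_add_one, Nat.add_sub_cancel, pow_succ]
    ring

theorem continuous_mehlerSlope (s : ℝ) (ρ : Op n) : Continuous fun r => mehlerSlope r s ρ := by
  refine continuous_matrix fun x y => ?_
  simp only [mehlerSlope, Matrix.of_apply]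
  fun_prop

theorem tau_re (A : Op n) : (tau A).re = (2 ^ n : ℝ)⁻¹ * A.trace.re := by
  have : ((2 : ℂ) ^ n)⁻¹ = (((2 ^ n : ℝ)⁻¹ : ℝ) : ℂ) := by push_cast; rfl
  rw [tau, this, Complex.re_ofReal_mul]

/-- Klein's inequality for densities: the entropy lies above its tangents. -/
theorem entropy_sub_ge {ρ σ : Op n} (hρ : ρ ∈ densPos n) (hσ : σ ∈ densPos n) :
    (tau (cfc Real.log σ * (ρ - σ))).re ≤ entropy ρ - entropy σ := by
  have h := klein hρ.2.1 hσ.2.1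
  have ht : (ρ - σ).trace.re = 0 := by
    have h1 : tau ρ = tau σ := by rw [hρ.2.2, hσ.2.2]
    have h2 : ρ.trace = σ.trace := mul_left_cancel₀ (by positivity) h1
    rw [Matrix.trace_sub, h2, sub_self, Complex.zero_re]
  rw [ht] at h
  rw [entropy, entropy, tau_re, tau_re, tau_re, mul_sub, Matrix.trace_sub,
    Matrix.trace_mul_comm _ ρ, Matrix.trace_mul_comm _ σ, Complex.sub_re, ← mul_sub]
  exact mul_le_mul_of_nonneg_left (by linarith) (by positivity)

/-- The derivative of the entropy along the Mehler semigroup, obtained by squeezing the difference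
quotient between two tangents. -/
theorem hasDerivWithinAt_entropy_mehler {ρ : Op n} (hρ : ρ ∈ densPos n) {s : ℝ}
    (hs : s ∈ Set.Icc (0 : ℝ) 1) :
    HasDerivWithinAt (fun r => entropy (mehler r ρ))
      (tau (cfc Real.log (mehler s ρ) * mehlerSlope s s ρ)).re (Set.Icc 0 1) s := by
  rw [hasDerivWithinAt_iff_tendsto_slope]
  set f : ℝ → ℝ := fun r => (tau (cfc Real.log (mehler s ρ) * mehlerSlope r s ρ)).re with hf
  set g : ℝ → ℝ := fun r => (tau (cfc Real.log (mehler r ρ) * mehlerSlope r s ρ)).re with hg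
  have htau : Continuous fun A : Op n => (tau A).re := by
    unfold tau
    exact Complex.continuous_re.comp (continuous_const.mul (by fun_prop))
  have hfc : Filter.Tendsto f (nhdsWithin s (Set.Icc 0 1 \ {s})) (nhds (f s)) :=
    (htau.comp (continuous_const.mul (continuous_mehlerSlope s ρ))).continuousAt.tendsto.mono_left
      nhdsWithin_le_nhds
  have hgc : Filter.Tendsto g (nhdsWithin s (Set.Icc 0 1 \ {s})) (nhds (f s)) :=
    ((htau.comp_continuousOn ((continuousOn_log_mehler hρ).mul
      (continuous_mehlerSlope s ρ).continuousOn)) s hs).tendsto.mono_left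
        (nhdsWithin_mono _ Set.sdiff_subset)
  have hmin := hfc.min hgc
  have hmax := hfc.max hgc
  rw [min_self] at hmin
  rw [max_self] at hmax
  have key : ∀ r ∈ Set.Icc (0 : ℝ) 1 \ {s},
      min (f r) (g r) ≤ slope (fun r => entropy (mehler r ρ)) s r ∧
      slope (fun r => entropy (mehler r ρ)) s r ≤ max (f r) (g r) := by
    intro r hr
    have hlin : ∀ L : Op n, (tau (L * (mehler r ρ - mehler s ρ))).re =
        (r - s) * (tau (L * mehlerSlope r s ρ)).re := fun L => by
      rw [mehler_sub_mehler, mul_smul_comm, tau_re, tau_re, Matrix.trace_smul, smul_eq_mul,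
        Complex.re_ofReal_mul]
      ring
    have h1 := entropy_sub_ge (mehler_mem_densPos hr.1 hρ) (mehler_mem_densPos hs hρ)
    have h2 := entropy_sub_ge (mehler_mem_densPos hs hρ) (mehler_mem_densPos hr.1 hρ)
    rw [← neg_sub (mehler r ρ), mul_neg, tau_re, Matrix.trace_neg, Complex.neg_re, mul_neg,
      ← tau_re] at h2
    rw [hlin] at h1 h2
    rw [slope_def_field]
    rcases lt_or_gt_of_ne (show r ≠ s from hr.2) with h | h
    · have hneg : r - s < 0 := sub_neg.2 h
      refine ⟨(min_le_right _ _).trans ?_, le_trans ?_ (le_max_left _ _)⟩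
      · rw [le_div_iff_of_neg hneg]; simp only [hg]; linarith
      · rw [div_le_iff_of_neg hneg]; simp only [hf]; linarith
    · have hpos : 0 < r - s := sub_pos.2 h
      refine ⟨(min_le_left _ _).trans ?_, le_trans ?_ (le_max_right _ _)⟩
      · rw [le_div_iff₀ hpos]; simp only [hf]; linarith
      · rw [div_le_iff₀ hpos]; simp only [hg]; linarith
  exact tendsto_of_tendsto_of_tendsto_of_le_of_le' hmin hmax
    (Filter.eventually_of_mem self_mem_nhdsWithin fun r hr => (key r hr).1)
    (Filter.eventually_of_mem self_mem_nhdsWithin fun r hr => (key r hr).2)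

/-! ### Length of the Mehler curve -/

/-- The speed of the curve `t ↦ mehler (1 - t) ρ` at `r = 1 - t`. -/
noncomputable def mehlerSpeed (ρ : Op n) (r : ℝ) : ℝ := Real.sqrt (fisher (mehler r ρ)) / r

theorem mehlerSpeed_nonneg (ρ : Op n) {r : ℝ} (hr : 0 ≤ r) : 0 ≤ mehlerSpeed ρ r :=
  div_nonneg (Real.sqrt_nonneg _) hr

theorem mul_mehlerSpeed_sq {ρ : Op n} (hρ : ρ ∈ densPos n) {r : ℝ} (hr : r ∈ Set.Ioc (0 : ℝ) 1) :
    r * mehlerSpeed ρ r ^ 2 = (tau (cfc Real.log (mehler r ρ) * mehlerSlope r r ρ)).re := by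
  have h : fisher (mehler r ρ) =
      r * (tau (cfc Real.log (mehler r ρ) * mehlerSlope r r ρ)).re := by
    rw [fisher, ← smul_mehlerSlope_self, mul_smul_comm, tau_re, tau_re, Matrix.trace_smul,
      smul_eq_mul, Complex.re_ofReal_mul]
    ring
  have h0 := fisher_nonneg (mehler_mem_densPos ⟨hr.1.le, hr.2⟩ hρ)
  rw [mehlerSpeed, div_pow, Real.sq_sqrt h0, h]
  have := hr.1.ne'
  field_simp

/-- Decay of the Fisher information, restated: the Mehler curve, parametrised by `r = e^{-t}`, has
nondecreasing speed. -/
theorem monotoneOn_mehlerSpeed {ρ : Op n} (hρ : ρ ∈ densPos n) :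
    MonotoneOn (mehlerSpeed ρ) (Set.Icc 0 1) := by
  intro r hr s hs hrs
  rcases eq_or_lt_of_le hr.1 with h0 | h0
  · rw [← h0, mehlerSpeed, div_zero]
    exact mehlerSpeed_nonneg ρ hs.1
  have hs0 : 0 < s := h0.trans_le hrs
  have hq : r / s ∈ Set.Icc (0 : ℝ) 1 := ⟨by positivity, (div_le_one hs0).2 hrs⟩
  have h := fisher_mehler_le hq (mehler_mem_densPos hs hρ)
  rw [mehler_mehler, div_mul_cancel₀ _ hs0.ne'] at h
  have h2 := Real.sqrt_le_sqrt h
  rw [Real.sqrt_mul (sq_nonneg _), Real.sqrt_sq hq.1] at h2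
  rw [mehlerSpeed, mehlerSpeed, div_le_iff₀ h0]
  exact h2.trans_eq (by ring)

theorem continuousOn_mehlerSpeed {ρ : Op n} (hρ : ρ ∈ densPos n) :
    ContinuousOn (mehlerSpeed ρ) (Set.Ioc 0 1) := by
  unfold mehlerSpeed
  refine ContinuousOn.div ?_ continuousOn_id fun r hr => hr.1.ne'
  refine Real.continuous_sqrt.comp_continuousOn ?_
  have hnum : Continuous fun r => numberOp (mehler r ρ) := by
    refine continuous_matrix fun x y => ?_
    simp only [numberOp, Matrix.of_apply, mehler_apply]
    fun_prop
  have htau : Continuous fun A : Op n => (tau A).re := by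
    unfold tau
    exact Complex.continuous_re.comp (continuous_const.mul (by fun_prop))
  exact htau.comp_continuousOn
    (((continuousOn_log_mehler hρ).mono Set.Ioc_subset_Icc_self).mul hnum.continuousOn)

/-- If `k` is nonnegative and nondecreasing and `S' = r k ^ 2`, then `L = ∫₀ʳ k ≤ r k` gives
`(L ^ 2)' ≤ 2 S'`, hence `∫₀¹ k ≤ √(2 S(1))`. -/
theorem integral_le_sqrt_of_monotoneOn {k S : ℝ → ℝ} (hk : MonotoneOn k (Set.Icc 0 1))
    (hkc : ContinuousOn k (Set.Ioc 0 1)) (hk0 : ∀ r ∈ Set.Icc (0 : ℝ) 1, 0 ≤ k r)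
    (hS : ContinuousOn S (Set.Icc 0 1))
    (hS' : ∀ r ∈ Set.Ioo (0 : ℝ) 1, HasDerivAt S (r * k r ^ 2) r) (hS0 : 0 ≤ S 0) :
    ∫ r in (0 : ℝ)..1, k r ≤ Real.sqrt (2 * S 1) := by
  have hint : ∀ r ∈ Set.Icc (0 : ℝ) 1, IntervalIntegrable k MeasureTheory.volume 0 r := by
    intro r hr
    refine MonotoneOn.intervalIntegrable (hk.mono ?_)
    rw [Set.uIcc_of_le hr.1]
    exact Set.Icc_subset_Icc_right hr.2
  set L : ℝ → ℝ := fun r => ∫ t in (0 : ℝ)..r, k t with hL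
  have hL0 : ∀ r ∈ Set.Icc (0 : ℝ) 1, 0 ≤ L r := fun r hr =>
    intervalIntegral.integral_nonneg hr.1 fun t ht => hk0 t ⟨ht.1, ht.2.trans hr.2⟩
  have hLle : ∀ r ∈ Set.Icc (0 : ℝ) 1, L r ≤ r * k r := by
    intro r hr
    calc L r ≤ ∫ _ in (0 : ℝ)..r, k r :=
          intervalIntegral.integral_mono_on hr.1 (hint r hr) intervalIntegrable_const
            fun t ht => hk ⟨ht.1, ht.2.trans hr.2⟩ hr ht.2
      _ = r * k r := by simp
  have hLc : ContinuousOn L (Set.Icc 0 1) := by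
    have := intervalIntegral.continuousOn_primitive_interval
      ((intervalIntegrable_iff' (by simp)).1 (hint 1 ⟨zero_le_one, le_rfl⟩))
    rwa [Set.uIcc_of_le zero_le_one] at this
  have hLd : ∀ r ∈ Set.Ioo (0 : ℝ) 1, HasDerivAt L (k r) r := by
    intro r hr
    have hopen : ContinuousOn k (Set.Ioo 0 1) := hkc.mono Set.Ioo_subset_Ioc_self
    exact intervalIntegral.integral_hasDerivAt_right (hint r ⟨hr.1.le, hr.2.le⟩)
      (hopen.stronglyMeasurableAtFilter isOpen_Ioo r hr)
      (hopen.continuousAt (isOpen_Ioo.mem_nhds hr))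
  have hHd : ∀ r ∈ Set.Ioo (0 : ℝ) 1, HasDerivAt (fun r => 2 * S r - L r ^ 2)
      (2 * (r * k r ^ 2) - 2 * L r * k r) r := by
    intro r hr
    refine (((hS' r hr).const_mul 2).sub ((hLd r hr).pow 2)).congr_deriv ?_
    simp
  have hmono : MonotoneOn (fun r => 2 * S r - L r ^ 2) (Set.Icc 0 1) := by
    refine monotoneOn_of_deriv_nonneg (convex_Icc 0 1)
      ((continuousOn_const.mul hS).sub (hLc.pow 2)) ?_ ?_
    · rw [interior_Icc]
      exact fun r hr => (hHd r hr).differentiableAt.differentiableWithinAt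
    · rw [interior_Icc]
      intro r hr
      rw [(hHd r hr).deriv]
      have hr' := Set.Ioo_subset_Icc_self hr
      nlinarith [mul_le_mul_of_nonneg_right (hLle r hr') (hk0 r hr')]
  have h01 := hmono ⟨le_rfl, zero_le_one⟩ ⟨zero_le_one, le_rfl⟩ (zero_le_one' ℝ)
  have hL00 : L 0 = 0 := by simp [hL]
  simp only [hL00] at h01
  exact Real.le_sqrt_of_sq_le (by linarith)

theorem integral_mehlerSpeed_le {ρ : Op n} (hρ : ρ ∈ densPos n) :
    ∫ r in (0 : ℝ)..1, mehlerSpeed ρ r ≤ Real.sqrt (2 * entropy ρ) := by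
  have hS : ContinuousOn (fun r => entropy (mehler r ρ)) (Set.Icc 0 1) := fun r hr =>
    (hasDerivWithinAt_entropy_mehler hρ hr).continuousWithinAt
  have h := integral_le_sqrt_of_monotoneOn (monotoneOn_mehlerSpeed hρ)
    (continuousOn_mehlerSpeed hρ) (fun r hr => mehlerSpeed_nonneg ρ hr.1) hS (fun r hr => by
      rw [mul_mehlerSpeed_sq hρ ⟨hr.1, hr.2.le⟩]
      exact (hasDerivWithinAt_entropy_mehler hρ ⟨hr.1.le, hr.2.le⟩).hasDerivAt
        (Icc_mem_nhds hr.1 hr.2))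
    (by
      have h1 : cfc Real.log (1 : Op n) = 0 := by
        rw [cfc_apply_one, Real.log_one, map_zero]
      simp [mehler_zero hρ.1 hρ.2.2, entropy, h1, tau])
  simpa only [mehler_one] using h

theorem arclength_mehler {ρ : Op n} (hρ : ρ ∈ densPos n) :
    arclength (fun t => mehler (1 - t) ρ) =
      ENNReal.ofReal (∫ r in (0 : ℝ)..1, mehlerSpeed ρ r) := by
  have hspeed : ∀ t ∈ Set.Ioo (0 : ℝ) 1,
      metric (mehler (1 - t) ρ) (velocity (fun t => mehler (1 - t) ρ) t) ^ (1 / 2 : ℝ) =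
        ENNReal.ofReal (mehlerSpeed ρ (1 - t)) := by
    intro t ht
    have hr : 1 - t ∈ Set.Icc (0 : ℝ) 1 := ⟨by linarith [ht.2], by linarith [ht.1]⟩
    have hI := fisher_nonneg (mehler_mem_densPos hr hρ)
    have hsq : (-(1 - t)⁻¹) ^ 2 * fisher (mehler (1 - t) ρ) = mehlerSpeed ρ (1 - t) ^ 2 := by
      rw [mehlerSpeed, div_pow, Real.sq_sqrt hI, neg_sq, inv_pow, div_eq_inv_mul]
    rw [velocity_mehler ρ ht.2, metric_smul_numberOp (mehler_mem_densPos hr hρ), hsq,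
      ENNReal.ofReal_rpow_of_nonneg (sq_nonneg _) (by norm_num), ← Real.sqrt_eq_rpow,
      Real.sqrt_sq (mehlerSpeed_nonneg ρ hr.1)]
  have hint : IntervalIntegrable (fun t => mehlerSpeed ρ (1 - t)) MeasureTheory.volume 0 1 := by
    have hm : AntitoneOn (fun t => mehlerSpeed ρ (1 - t)) (Set.uIcc 0 1) := by
      rw [Set.uIcc_of_le zero_le_one]
      intro s hs t ht hst
      exact monotoneOn_mehlerSpeed hρ ⟨by linarith [ht.2], by linarith [ht.1]⟩
        ⟨by linarith [hs.2], by linarith [hs.1]⟩ (by linarith)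
    exact hm.intervalIntegrable
  rw [arclength, MeasureTheory.setLIntegral_congr_fun measurableSet_Ioo hspeed,
    ← MeasureTheory.ofReal_integral_eq_lintegral_ofReal
      (hint.1.mono_set Set.Ioo_subset_Ioc_self)
      ((MeasureTheory.ae_restrict_iff' measurableSet_Ioo).2 (Filter.Eventually.of_forall
        fun t ht => mehlerSpeed_nonneg ρ (by linarith [ht.2]))),
    ← MeasureTheory.integral_Ioc_eq_integral_Ioo, ← intervalIntegral.integral_of_le zero_le_one,
    intervalIntegral.integral_comp_sub_left (fun r => mehlerSpeed ρ r) 1]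
  simp

end FermiClifford

theorem theorem4p3 (n : ℕ) (ρ : FermiClifford.Op n) (hρ : ρ ∈ FermiClifford.densPos n) :
    FermiClifford.riemannianDist ρ 1 ≤ ENNReal.ofReal (Real.sqrt (2 * FermiClifford.entropy ρ)) :=
  (iInf₂_le _ (FermiClifford.isCoupling_mehler hρ)).trans
    ((FermiClifford.arclength_mehler hρ).trans_le
      (ENNReal.ofReal_le_ofReal (FermiClifford.integral_mehlerSpeed_le hρ)))
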